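/- **Setting.** Let $(X,\mu)$ be a standard Borel probability space and $\mathcal R\subseteq X\times X$ a discrete measure-preserving equivalence relation: $\mathcal R$ is measurable, for a.e. $x$ it is reflexive, symmetric and transitive at $x$ with countable class, and for measurable $B\subseteq\mathcal R$ the section counts are ($\mu$-a.e.) measurable and $\int|\{y:(x,y)\in B\}|\,d\mu(x)=\int|\{y:(y,x)\in B\}|\,d\mu(x)=:\overline\mu(B)$. Let $[[\mathcal R]]$ be the set of partial $\mathcal R$-morphisms, i.e. bimeasurable bijections $\phi$ between measurable sets $\mathrm{dom}\,\phi,\mathrm{ran}\,\phi\subseteq X$ with $(\phi(x),x)\in\mathcal R$ for a.e. $x\in\mathrm{dom}\,\phi$ and $(\phi^{-1}(x),x)\in\mathcal R$ for a.e. $x\in\mathrm{ran}\,\phi$; write $\phi^*=\phi^{-1}$. On $L^2(\mathcal R,\overline\mu)$ let $v_\phi f(x,y)=\chi_{\mathrm{ran}\,\phi}(x)f(\phi^{-1}x,y)$. Let $\mathcal A=\{\sum c_\phi v_\phi \text{ (finite sums)}\}$ be the $*$-algebra generated by $[[\mathcal R]]$ and the projections of $L^\infty(X,\mu)$ (identify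 $\chi_A$ with $\mathrm{id}_A$), with $\tau(x)=\langle x\chi_D,\chi_D\rangle$, $D$ the diagonal, and $\|x\|_2=\tau(x^*x)^{1/2}$. A *sofic approximation* $\Sigma$ is a sequence of maps $\sigma_i:\mathcal A\to M_{d_i}(\mathbb C)$ sending $[[\mathcal R]]$ to partial permutation matrices and projections of $L^\infty(X,\mu)$ to diagonal projections, such that for all $x,y\in\mathcal A$, $\lambda\in\mathbb C$: $\sigma_i(xy)-\sigma_i(x)\sigma_i(y)$, $\sigma_i(x^*)-\sigma_i(x)^*$, $\sigma_i(x+y)-\sigma_i(x)-\sigma_i(y)$, $\sigma_i(\lambda x)-\lambda\sigma_i(x)$ tend to $0$ in the normalized $\|\cdot\|_2$, $\mathrm{tr}\,\sigma_i(x)\to\tau(x)$ ($\mathrm{tr}$ the normalized trace), and $\sup_i\|\sigma_i(x)\|_\infty<\infty$ (operator norm). A (uniformly bounded) *representation* of $\mathcal R$ on a complex Banach space $V$ assigns to each $\phi\in[[\mathcal R]]$ a bounded linear map $v\mapsto\phi v$, with norms bounded uniformly in $\phi$, such that $\phi(\psi v)=(\phi\psi)v$, $\phi^{-1}\phi v=\mathrm{id}_{\mathrm{dom}\,\phi}v$,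 $\phi v$ depends only on $\phi$ up to null sets, $\mathrm{id}_Xv=v$, $\phi_nv\to\phi v$ whenever $\|v_{\phi_n}-v_\phi\|_2\to0$, and $\mathrm{id}_{A\cup B}v=\mathrm{id}_Av+\mathrm{id}_Bv$ for disjoint measurable $A,B$. A bounded sequence $S=(v_j)_{j\ge1}$ in $V$ is *dynamically generating* if the $\phi v_j$ ($\phi\in[[\mathcal R]]$, $j\ge1$) span a dense subspace. A *generating family* is $\Phi=\Phi_0\cup\mathcal P\subseteq[[\mathcal R]]$, where $\Phi_0$ is a graphing (a countable set of partial morphisms whose graphs generate $\mathcal R$ a.e. as an equivalence relation) and $\mathcal P$ is a set of projections of $L^\infty(X,\mu)$ such that the projections $v_wpv_w^*$, with $p\in\mathcal P$ and $w$ a finite product of elements of $\Phi_0\cup\{\mathrm{id}\}\cup\Phi_0^*$, generate $L^\infty(X,\mu)$ as a von Neumann algebra. A *product norm* is a norm $\rho$ on $\ell^\infty(\mathbb N)$ with $\rho(f)\le\rho(g)$ whenever $|f|\le|g|$, inducing on $\{\|f\|_\infty\le1\}$ the topology of pointwise convergence. **Dimension.** Let $1\le p<\infty$. For finite $F\subseteq\Phi$,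 $m\in\mathbb N$, $\delta>0$, let $V_{F,m}$ be the span of the $wv_j$, $j\le m$, with $w$ a product of at most $m$ elements of $F\cup\{\mathrm{id}\}\cup F^*$. Let $\mathrm{Hom}_{\mathcal R,\ell^p}(S,F,m,\delta,\sigma_i)$ be the set of linear $T:V_{F,m}\to\ell^p(d_i)$ with $\|T\|\le1$ for which there is $A\subseteq\{1,\dots,d_i\}$, $|A|\ge(1-\delta)d_i$, with $$\|T(\phi_1\cdots\phi_kv_j)-\sigma_i(\phi_1)\cdots\sigma_i(\phi_k)T(v_j)\|_{\ell^p(A)}<\delta\qquad(j,k\le m,\ \phi_1,\dots,\phi_k\in F\cup\{\mathrm{id}\}\cup F^*).$$ Let $\alpha_S(T)\in\ell^\infty(\mathbb N,\ell^p(d_i))$ be $\alpha_S(T)(j)=T(v_j)$ for $j\le m$ and $0$ for $j>m$. For $K\subseteq\ell^\infty(\mathbb N,\ell^p(n))$ let $d_\varepsilon(K,\rho)$ be the least dimension of a linear subspace $G$ such that for each $f\in K$ there are $g\in G$ and $C\subseteq\{1,\dots,n\}$ with $|C|\ge(1-\varepsilon)n$ and $\rho\big(j\mapsto\|\chi_C(f(j)-g(j))\|_p\big)<\varepsilon$.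 Put $$\dim_{\Sigma,\ell^p}(V,\mathcal R;S,\Phi,\rho)=\sup_{\varepsilon>0}\ \liminf_{(F,m,\delta)}\ \limsup_{i\to\infty}\frac1{d_i}\,d_\varepsilon\big(\alpha_S(\mathrm{Hom}_{\mathcal R,\ell^p}(S,F,m,\delta,\sigma_i)),\rho\big)\in[0,\infty],$$ where $(F,m,\delta)$ is directed by enlarging $F$ and $m$ and shrinking $\delta>0$. The dimension $\dim_{\Sigma,\ell^p}(V,\mathcal R)$ is this number, computed with any dynamically generating sequence $S$ of $V$, any generating family $\Phi$ and any product norm $\rho$. **Proposition.** Let $V,W$ be uniformly bounded representations of $\mathcal R$ on Banach spaces which admit dynamically generating sequences, let $\Sigma$ be a sofic approximation of $\mathcal R$ and let $1\le p<\infty$. If there is a bounded linear $\mathcal R$-equivariant map $T:W\to V$ with dense image, then $$\dim_{\Sigma,\ell^p}(V,\mathcal R)\le\dim_{\Sigma,\ell^p}(W,\mathcal R),$$ whatever choices $(S_V,\Phi_V,\rho_V)$ and $(S_W,\Phi_W,\rho_W)$ are used to compute the two sides. In particular, if $T$ is moreover bijective (an isomorphism of representations), the two dimensions are equal, again for all choices.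 -/

import Mathlib

open MeasureTheory Filter Topology
open scoped ENNReal ComplexConjugate

noncomputable section

namespace LpDim

/-! ### Discrete measure-preserving equivalence relations -/

/-- A discrete measure-preserving equivalence relation on `(X, μ)`.
`Measure.count` of a section is its cardinality. -/
structure MPRel (X : Type*) [MeasurableSpace X] (μ : Measure X) where
  rel : Set (X × X)
  measurableSet_rel : MeasurableSet rel
  ae_refl : ∀ᵐ x ∂μ, (x, x) ∈ rel
  ae_trans : ∀ᵐ x ∂μ, ∀ y z, (x, y) ∈ rel → (y, z) ∈ rel → (x, z) ∈ rel
  ae_symm : ∀ᵐ x ∂μ, ∀ y, (x, y) ∈ rel → (y, x) ∈ rel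
  ae_countable : ∀ᵐ x ∂μ, {y | (x, y) ∈ rel}.Countable
  aemeasurable_left : ∀ B ⊆ rel, MeasurableSet B →
    AEMeasurable (fun x => Measure.count {y | (x, y) ∈ B}) μ
  aemeasurable_right : ∀ B ⊆ rel, MeasurableSet B →
    AEMeasurable (fun x => Measure.count {y | (y, x) ∈ B}) μ
  lintegral_count_eq : ∀ B ⊆ rel, MeasurableSet B →
    ∫⁻ x, Measure.count {y | (x, y) ∈ B} ∂μ = ∫⁻ x, Measure.count {y | (y, x) ∈ B} ∂μ

section Basic

variable {X : Type*} [MeasurableSpace X] {μ : Measure X}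

/-- The measure `B ↦ ∫ |{y : (x, y) ∈ B ∩ R}| dμ(x)`, as a measure on `X × X` carried by `R`. -/
def MPRel.mubar (R : MPRel X μ) : Measure (X × X) :=
  Measure.ofMeasurable
    (fun B _ => ∫⁻ x, Measure.count {y | (x, y) ∈ B ∩ R.rel} ∂μ)
    (by simp)
    (by
      intro B hB hd
      have key : ∀ x, Measure.count {y | (x, y) ∈ (⋃ i, B i) ∩ R.rel}
          = ∑' i, Measure.count {y | (x, y) ∈ B i ∩ R.rel} := by
        intro x
        have : {y | (x, y) ∈ (⋃ i, B i) ∩ R.rel} = ⋃ i, {y | (x, y) ∈ B i ∩ R.rel} := by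
          ext y; simp
        rw [this, measure_iUnion]
        · intro i j hij
          rw [Function.onFun, Set.disjoint_left]
          intro y h1 h2
          exact Set.disjoint_left.1 (hd hij) h1.1 h2.1
        · intro i
          exact measurable_prodMk_left ((hB i).inter R.measurableSet_rel)
      simp only [key]
      exact lintegral_tsum fun i => R.aemeasurable_left _ Set.inter_subset_right
        ((hB i).inter R.measurableSet_rel))

/-! ### Partial morphisms -/

/-- A (representative of a) partial `R`-morphism: a bimeasurable bijection between measurable
subsets of `X` that moves almost every point inside its class. The condition is imposed on the
map and on its inverse, so that null sets are preserved in both directions. -/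
structure PMorph (R : MPRel X μ) where
  toPE : PartialEquiv X X
  measurableSet_source : MeasurableSet toPE.source
  measurableSet_target : MeasurableSet toPE.target
  measurable_map : ∀ s, MeasurableSet s → MeasurableSet (toPE.source ∩ toPE ⁻¹' s)
  measurable_inv : ∀ s, MeasurableSet s → MeasurableSet (toPE.target ∩ toPE.symm ⁻¹' s)
  ae_rel : ∀ᵐ x ∂μ, x ∈ toPE.source → (toPE x, x) ∈ R.rel
  ae_rel_symm : ∀ᵐ x ∂μ, x ∈ toPE.target → (toPE.symm x, x) ∈ R.rel

namespace PMorph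

variable {R : MPRel X μ}

@[ext]
theorem ext_toPE {φ ψ : PMorph R} (h : φ.toPE = ψ.toPE) : φ = ψ := by
  cases φ; cases ψ; cases h; rfl

/-- The inverse partial morphism; it is the adjoint `v_φ^* = v_{φ⁻¹}`. -/
def inv (φ : PMorph R) : PMorph R where
  toPE := φ.toPE.symm
  measurableSet_source := φ.measurableSet_target
  measurableSet_target := φ.measurableSet_source
  measurable_map := φ.measurable_inv
  measurable_inv := φ.measurable_map
  ae_rel := φ.ae_rel_symm
  ae_rel_symm := φ.ae_rel

/-- The identity of a measurable set `A`, viewed as a partial morphism `A → A`; it is the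
projection `χ_A` of `L^∞(X, μ)`. -/
def idOn (R : MPRel X μ) (A : Set X) (hA : MeasurableSet A) : PMorph R where
  toPE := PartialEquiv.ofSet A
  measurableSet_source := hA
  measurableSet_target := hA
  measurable_map := fun _ hs => hA.inter hs
  measurable_inv := fun _ hs => hA.inter hs
  ae_rel := by
    filter_upwards [R.ae_refl] with x hx _ using hx
  ae_rel_symm := by
    filter_upwards [R.ae_refl] with x hx _ using hx

theorem measure_preimage_null [StandardBorelSpace X] (φ : PMorph R) {N : Set X} (hN : μ N = 0) :
    μ (φ.toPE.source ∩ φ.toPE ⁻¹' N) = 0 := by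
  set M := toMeasurable μ N with hM
  have hMm : MeasurableSet M := measurableSet_toMeasurable μ N
  have hM0 : μ M = 0 := by rw [hM, measure_toMeasurable, hN]
  set E := φ.toPE.source ∩ φ.toPE ⁻¹' M with hE
  have hEm : MeasurableSet E := φ.measurable_map M hMm
  suffices h : μ E = 0 from
    measure_mono_null (Set.inter_subset_inter_right _
      (Set.preimage_mono (subset_toMeasurable μ N))) h
  classical
  have hgr : MeasurableSet {z : X × X | z.2 ∈ E ∧ φ.toPE z.2 = z.1} := by
    have h1 : Measurable fun x : E => φ.toPE x := by
      intro s hs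
      have : ((fun x : E => φ.toPE x) ⁻¹' s) = Subtype.val ⁻¹' (φ.toPE.source ∩ φ.toPE ⁻¹' s) := by
        ext x
        simp only [Set.mem_preimage, Set.mem_inter_iff]
        exact ⟨fun h => ⟨x.2.1, h⟩, fun h => h.2⟩
      rw [this]
      exact measurable_subtype_coe (φ.measurable_map s hs)
    have h2 : MeasurableSet {p : X × E | φ.toPE p.2 = p.1} :=
      measurableSet_eq_fun (h1.comp measurable_snd) measurable_fst
    have he : MeasurableEmbedding (Prod.map id Subtype.val : X × E → X × X) :=
      MeasurableEmbedding.id.prodMap (MeasurableEmbedding.subtype_coe hEm)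
    have := he.measurableSet_image.2 h2
    convert this using 1
    ext z
    constructor
    · rintro ⟨h, h'⟩
      exact ⟨(z.1, ⟨z.2, h⟩), h', rfl⟩
    · rintro ⟨p, hp, rfl⟩
      exact ⟨p.2.2, hp⟩
  set B := {z : X × X | z.2 ∈ E ∧ φ.toPE z.2 = z.1} ∩ R.rel with hB
  have hBm : MeasurableSet B := hgr.inter R.measurableSet_rel
  have h1 : ∫⁻ x, Measure.count {y | (x, y) ∈ B} ∂μ = 0 := by
    have : ∀ᵐ x ∂μ, x ∉ M := by
      rw [ae_iff]; simpa using hM0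
    rw [lintegral_congr_ae (g := fun _ => 0)]
    · simp
    · filter_upwards [this] with x hx
      have : {y | (x, y) ∈ B} = ∅ := by
        ext y
        simp only [Set.mem_empty_iff_false, iff_false]
        rintro ⟨⟨hy, hyx⟩, -⟩
        exact hx ((show φ.toPE y = x from hyx) ▸ hy.2)
      simp [this]
  have h2 : μ E ≤ ∫⁻ x, Measure.count {y | (y, x) ∈ B} ∂μ := by
    rw [← lintegral_indicator_one hEm]
    apply lintegral_mono_ae
    filter_upwards [φ.ae_rel] with x hx
    by_cases hxE : x ∈ E
    · have : {φ.toPE x} ⊆ {y | (y, x) ∈ B} := by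
        rintro _ rfl
        exact ⟨⟨hxE, rfl⟩, hx hxE.1⟩
      calc E.indicator 1 x = 1 := by simp [hxE]
        _ = Measure.count {φ.toPE x} := (Measure.count_singleton _).symm
        _ ≤ _ := measure_mono this
    · simp [hxE]
  rw [← R.lintegral_count_eq B Set.inter_subset_right hBm, h1] at h2
  exact le_antisymm h2 (zero_le)

theorem ae_of_ae [StandardBorelSpace X] (φ : PMorph R) {p : X → Prop} (h : ∀ᵐ x ∂μ, p x) :
    ∀ᵐ x ∂μ, x ∈ φ.toPE.source → p (φ.toPE x) := by
  have := φ.measure_preimage_null (N := {x | ¬ p x}) h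
  rw [ae_iff]
  convert this using 2
  ext x
  simp

theorem ae_rel_trans [StandardBorelSpace X] (φ ψ : PMorph R) :
    ∀ᵐ x ∂μ, x ∈ (ψ.toPE.trans φ.toPE).source → ((ψ.toPE.trans φ.toPE) x, x) ∈ R.rel := by
  have e1 := ψ.ae_of_ae ψ.ae_rel_symm
  have e2 := ψ.ae_of_ae (φ.ae_of_ae φ.ae_rel_symm)
  filter_upwards [R.ae_trans, R.ae_symm, e1, e2] with x ht hs h1 h2 hx
  rw [PartialEquiv.trans_source] at hx
  have a1 := h1 hx.1 (ψ.toPE.map_source hx.1)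
  rw [ψ.toPE.left_inv hx.1] at a1
  have a2 := h2 hx.1 hx.2 (φ.toPE.map_source hx.2)
  rw [φ.toPE.left_inv hx.2] at a2
  exact hs _ (ht _ _ a1 a2)

/-- The composition `φ ∘ ψ`, defined on `ψ⁻¹(dom φ)`. -/
def comp [StandardBorelSpace X] (φ ψ : PMorph R) : PMorph R where
  toPE := ψ.toPE.trans φ.toPE
  measurableSet_source := ψ.measurable_map _ φ.measurableSet_source
  measurableSet_target := φ.measurable_inv _ ψ.measurableSet_target
  measurable_map := by
    intro s hs
    have := ψ.measurable_map _ (φ.measurable_map s hs)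
    convert this using 1
    ext x
    simp [PartialEquiv.trans_source, and_assoc]
  measurable_inv := by
    intro s hs
    have := φ.measurable_inv _ (ψ.measurable_inv s hs)
    convert this using 1
    ext x
    simp [PartialEquiv.trans_target, and_assoc]
  ae_rel := ae_rel_trans φ ψ
  ae_rel_symm := ae_rel_trans ψ.inv φ.inv

/-- `[[R]]` is a monoid under composition, with unit `id_X`. -/
instance [StandardBorelSpace X] : Monoid (PMorph R) where
  mul φ ψ := comp φ ψ
  one := ⟨PartialEquiv.refl X, .univ, .univ, fun _ hs => by simpa using hs,
    fun _ hs => by simpa using hs, by filter_upwards [R.ae_refl] with x hx _ using hx,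
    by filter_upwards [R.ae_refl] with x hx _ using hx⟩
  mul_assoc φ ψ χ := ext_toPE (PartialEquiv.trans_assoc χ.toPE ψ.toPE φ.toPE).symm
  one_mul φ := ext_toPE (PartialEquiv.trans_refl φ.toPE)
  mul_one φ := ext_toPE (PartialEquiv.refl_trans φ.toPE)

/-- Equality almost everywhere of partial morphisms. -/
def AEEq (φ ψ : PMorph R) : Prop :=
  ∀ᵐ x ∂μ, (x ∈ φ.toPE.source ↔ x ∈ ψ.toPE.source) ∧
    (x ∈ φ.toPE.source → φ.toPE x = ψ.toPE x)

end PMorph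

/-! ### The `*`-algebra generated by `[[R]]` inside `L(R)` -/

/-- Finite formal sums `∑ c_φ φ` with `φ ∈ [[R]]`. Each stands for the operator `∑ c_φ v_φ` on
`L²(R, μ̄)`; these operators form the `*`-algebra generated by `[[R]]` (and by the projections
of `L^∞(X, μ)`, which are the `v_φ` with `φ = id_A`). -/
abbrev FormalSum [StandardBorelSpace X] (R : MPRel X μ) := MonoidAlgebra ℂ (PMorph R)

open Classical in
/-- `(v_φ f)(x, y) = χ_{ran φ}(x) f(φ⁻¹ x, y)`. -/
def vApply {R : MPRel X μ} (φ : PMorph R) (f : X × X → ℂ) : X × X → ℂ :=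
  fun z => if z.1 ∈ φ.toPE.target then f (φ.toPE.symm z.1, z.2) else 0

variable [StandardBorelSpace X] {R : MPRel X μ}

/-- The operator `v_φ` as an element of the algebra. -/
def vv (φ : PMorph R) : FormalSum R := MonoidAlgebra.single φ 1

/-- `(∑ c_φ v_φ) f`. -/
def opApply (x : FormalSum R) (f : X × X → ℂ) : X × X → ℂ :=
  fun z => Finsupp.sum (MonoidAlgebra.coeff x) fun φ c => c * vApply φ f z

/-- Two formal sums are equal as operators on `L²(R, μ̄)`. -/
def SameOp (x y : FormalSum R) : Prop :=
  ∀ f : X × X → ℂ, MemLp f 2 R.mubar → opApply x f =ᵐ[R.mubar] opApply y f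

/-- The adjoint `(∑ c_φ v_φ)^* = ∑ conj c_φ v_{φ⁻¹}`. -/
def adj (x : FormalSum R) : FormalSum R :=
  Finsupp.sum (MonoidAlgebra.coeff x) fun φ c => MonoidAlgebra.single φ.inv (conj c)

/-- The characteristic function `χ_D` of the diagonal. -/
def diagFun (X : Type*) : X × X → ℂ := Set.indicator {z | z.1 = z.2} 1

/-- The trace `τ(x) = ⟨x χ_D, χ_D⟩` in `L²(R, μ̄)`. -/
def tau (x : FormalSum R) : ℂ :=
  ∫ z, opApply x (diagFun X) z * conj (diagFun X z) ∂(R.mubar)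

/-- `‖x‖₂ = τ(x^* x)^{1/2}`. -/
def norm2 (x : FormalSum R) : ℝ := Real.sqrt (tau (adj x * x)).re

/-! ### Sofic approximations -/

/-- `‖M‖₂ = tr(M^* M)^{1/2}` for the normalized trace `tr = (1/n) Tr`. -/
def matNorm2 {n : ℕ} (M : Matrix (Fin n) (Fin n) ℂ) : ℝ :=
  Real.sqrt ((M.conjTranspose * M).trace.re / n)

/-- The operator norm on `B(ℓ²(n))`. -/
def matOpNorm {n : ℕ} (M : Matrix (Fin n) (Fin n) ℂ) : ℝ :=
  ‖Matrix.toEuclideanCLM (𝕜 := ℂ) M‖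

/-- A sofic approximation: maps `σ_i` from the `*`-algebra generated by `[[R]]` and the
projections of `L^∞(X, μ)` (by `congr_op`, `σ_i x` depends only on the operator given by `x`)
to `M_{d_i}(ℂ)`. The matrices of `[[R_n]]` are the partial permutation matrices. -/
structure SoficApprox (R : MPRel X μ) where
  d : ℕ → ℕ
  σ : ∀ i, FormalSum R → Matrix (Fin (d i)) (Fin (d i)) ℂ
  congr_op : ∀ i x y, SameOp x y → σ i x = σ i y
  map_pmorph : ∀ i (φ : PMorph R), ∃ e : Fin (d i) ≃. Fin (d i), σ i (vv φ) = e.toMatrix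
  map_proj : ∀ i (A : Set X) (hA : MeasurableSet A), ∃ s : Set (Fin (d i)),
    σ i (vv (PMorph.idOn R A hA)) = Matrix.diagonal (s.indicator 1)
  mul : ∀ x y, Tendsto (fun i => matNorm2 (σ i (x * y) - σ i x * σ i y)) atTop (𝓝 0)
  adjoint : ∀ x, Tendsto (fun i => matNorm2 (σ i (adj x) - (σ i x).conjTranspose)) atTop (𝓝 0)
  trace : ∀ x, Tendsto (fun i => (σ i x).trace / (d i : ℂ)) atTop (𝓝 (tau x))
  bounded : ∀ x, BddAbove (Set.range fun i => matOpNorm (σ i x))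
  add : ∀ x y, Tendsto (fun i => matNorm2 (σ i (x + y) - σ i x - σ i y)) atTop (𝓝 0)
  smul : ∀ (c : ℂ) x, Tendsto (fun i => matNorm2 (σ i (c • x) - c • σ i x)) atTop (𝓝 0)

/-! ### Graphings -/

/-- A graphing: a countable family of partial morphisms whose graphs generate `R`, almost
everywhere, as an equivalence relation. -/
def IsGraphing (Φ₀ : Set (PMorph R)) : Prop :=
  Φ₀.Countable ∧ ∀ᵐ x ∂μ, ∀ y, (x, y) ∈ R.rel →
    Relation.EqvGen (fun a b => ∃ φ ∈ Φ₀, a ∈ φ.toPE.source ∧ φ.toPE a = b) x y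

/-- `F ∪ {id} ∪ F^*`. -/
def letters (F : Set (PMorph R)) : Set (PMorph R) :=
  {φ | φ ∈ F ∨ φ = 1 ∨ φ.inv ∈ F}

/-- The projections `v_w χ_P v_w^*`, i.e. the sets `w(P ∩ dom w)`, with `P ∈ 𝒫` and `w` a finite
product of elements of `Φ₀ ∪ {id} ∪ Φ₀^*`, generate `L^∞(X, μ)` as a von Neumann algebra: every
measurable set agrees up to a null set with one from the generated `σ`-algebra. -/
def GeneratesLInfty (Φ₀ : Set (PMorph R)) (P : Set (Set X)) : Prop :=
  ∀ E : Set X, MeasurableSet E →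
    ∃ E' : Set X, MeasurableSet[MeasurableSpace.generateFrom
      {Q | ∃ w : List (PMorph R), (∀ φ ∈ w, φ ∈ letters Φ₀) ∧ ∃ A ∈ P,
        Q = w.prod.toPE '' (w.prod.toPE.source ∩ A)}] E' ∧ E =ᵐ[μ] E'

/-- `Φ = Φ₀ ∪ 𝒫` with a graphing `Φ₀` and a set `𝒫` of projections of `L^∞(X, μ)` whose
translates generate `L^∞(X, μ)`. -/
def IsGenerating (Φ : Set (PMorph R)) : Prop :=
  ∃ (Φ₀ : Set (PMorph R)) (P : Set (Set X)), IsGraphing Φ₀ ∧ (∀ A ∈ P, MeasurableSet A) ∧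
    GeneratesLInfty Φ₀ P ∧
    Φ = Φ₀ ∪ {φ | ∃ A ∈ P, ∃ hA : MeasurableSet A, φ = PMorph.idOn R A hA}

/-! ### Representations -/

/-- A uniformly bounded representation of `R` on `V`, by linear maps, additive on disjoint
projections. -/
structure UBRep (R : MPRel X μ) (V : Type*) [NormedAddCommGroup V] [NormedSpace ℂ V] where
  act : PMorph R → V →L[ℂ] V
  act_mul : ∀ φ ψ v, act φ (act ψ v) = act (φ * ψ) v
  act_inv : ∀ φ v, act φ.inv (act φ v) = act (PMorph.idOn R _ φ.measurableSet_source) v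
  act_congr : ∀ φ ψ, φ.AEEq ψ → act φ = act ψ
  act_one : ∀ v, act 1 v = v
  act_tendsto : ∀ (φs : ℕ → PMorph R) φ v,
    Tendsto (fun n => norm2 (vv φ - vv (φs n))) atTop (𝓝 0) →
    Tendsto (fun n => act (φs n) v) atTop (𝓝 (act φ v))
  act_union : ∀ (A B : Set X) (hA : MeasurableSet A) (hB : MeasurableSet B), Disjoint A B →
    act (PMorph.idOn R (A ∪ B) (hA.union hB)) =
      act (PMorph.idOn R A hA) + act (PMorph.idOn R B hB)
  bounded : ∃ C : ℝ, ∀ φ, ‖act φ‖ ≤ C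

/-- A dynamically generating sequence. -/
def DynGenerating {V : Type*} [NormedAddCommGroup V] [NormedSpace ℂ V] (π : UBRep R V)
    (S : ℕ → V) : Prop :=
  (∃ C : ℝ, ∀ j, ‖S j‖ ≤ C) ∧
    (Submodule.span ℂ {u | ∃ (φ : PMorph R) (j : ℕ), u = π.act φ (S j)}).topologicalClosure = ⊤

end Basic

/-! ### Product norms and approximate dimension -/

/-- `ℓ^p(n)`. -/
abbrev ellp (p : ℝ≥0∞) (n : ℕ) := PiLp p fun _ : Fin n => ℂ

/-- `ℓ^∞(ℕ, E)`. -/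
abbrev ellInfty (E : Type*) [NormedAddCommGroup E] := lp (fun _ : ℕ => E) ∞

/-- A product norm on `ℓ^∞(ℕ)`: a monotone norm inducing the topology of pointwise convergence
on the unit ball (both topologies are metrizable there, so sequences suffice). -/
structure ProductNorm where
  ρ : Seminorm ℂ (ellInfty ℂ)
  eq_zero : ∀ f, ρ f = 0 → f = 0
  mono : ∀ f g : ellInfty ℂ, (∀ j, ‖f j‖ ≤ ‖g j‖) → ρ f ≤ ρ g
  tendsto_iff : ∀ (f : ellInfty ℂ) (u : ℕ → ellInfty ℂ), ‖f‖ ≤ 1 → (∀ n, ‖u n‖ ≤ 1) →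
    (Tendsto (fun n => ρ (u n - f)) atTop (𝓝 0) ↔
      ∀ j, Tendsto (fun n => u n j) atTop (𝓝 (f j)))

section ApproxDim

variable {p : ℝ≥0∞} [Fact (1 ≤ p)] {n : ℕ}

open Classical in
/-- Multiplication by `χ_C` on `ℓ^p(n)`. -/
def cut (C : Finset (Fin n)) (f : ellp p n) : ellp p n :=
  WithLp.toLp p fun k => if k ∈ C then f k else 0

theorem norm_cut_le (C : Finset (Fin n)) (f : ellp p n) : ‖cut C f‖ ≤ ‖f‖ := by
  have h : ∀ k, ‖cut C f k‖ ≤ ‖f k‖ := by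
    intro k
    simp only [cut]
    split_ifs <;> simp
  rcases eq_or_ne p ∞ with rfl | hp
  · rw [PiLp.norm_eq_ciSup, PiLp.norm_eq_ciSup]
    exact ciSup_mono (Set.finite_range _).bddAbove h
  · have h0 : 0 < p.toReal :=
      ENNReal.toReal_pos (zero_lt_one.trans_le (Fact.out : 1 ≤ p)).ne' hp
    rw [PiLp.norm_eq_sum h0, PiLp.norm_eq_sum h0]
    gcongr with k
    exact h k

/-- The bounded scalar sequence `j ↦ ‖χ_C f(j)‖_p`. -/
def cutNormSeq (C : Finset (Fin n)) (f : ellInfty (ellp p n)) : ellInfty ℂ :=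
  ⟨fun j => ((‖cut C (f j)‖ : ℝ) : ℂ), by
    apply memℓp_infty
    refine ⟨‖f‖, ?_⟩
    rintro _ ⟨j, rfl⟩
    simp only [Complex.norm_real, norm_norm]
    exact (norm_cut_le C _).trans (lp.norm_apply_le_norm ENNReal.top_ne_zero f j)⟩

/-- `K` is `ε`-contained in `G`. -/
def EpsContained (ρ : ProductNorm) (ε : ℝ) (K G : Set (ellInfty (ellp p n))) : Prop :=
  ∀ f ∈ K, ∃ g ∈ G, ∃ C : Finset (Fin n), (1 - ε) * n ≤ C.card ∧ ρ.ρ (cutNormSeq C (f - g)) < ε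

/-- The smallest dimension of a linear subspace that `ε`-contains `K`. -/
def epsDim (ρ : ProductNorm) (ε : ℝ) (K : Set (ellInfty (ellp p n))) : ℝ≥0∞ :=
  ⨅ (G : Submodule ℂ (ellInfty (ellp p n))) (_ : FiniteDimensional ℂ G)
    (_ : EpsContained ρ ε K G), (Module.finrank ℂ G : ℝ≥0∞)

end ApproxDim

/-! ### Almost equivariant maps and the dimension -/

section Dimension

variable {X : Type*} [MeasurableSpace X] [StandardBorelSpace X] {μ : Measure X} {R : MPRel X μ}
  {V : Type*} [NormedAddCommGroup V] [NormedSpace ℂ V]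

/-- Words of length at most `m` in `F ∪ {id} ∪ F^*`. -/
def words (F : Set (PMorph R)) (m : ℕ) : Set (List (PMorph R)) :=
  {w | w.length ≤ m ∧ ∀ φ ∈ w, φ ∈ letters F}

/-- `V_{F,m}`, the span of the `w v_j` with `w` a word of length at most `m` and `j` among the
first `m` indices. -/
def wordSpan (π : UBRep R V) (S : ℕ → V) (F : Set (PMorph R)) (m : ℕ) : Submodule ℂ V :=
  Submodule.span ℂ {u | ∃ w ∈ words F m, ∃ j < m, u = π.act w.prod (S j)}

/-- `w v_j` as an element of `V_{F,m}`. -/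
def wordVec (π : UBRep R V) (S : ℕ → V) (F : Set (PMorph R)) (m : ℕ)
    (w : List (PMorph R)) (hw : w ∈ words F m) (j : ℕ) (hj : j < m) : wordSpan π S F m :=
  ⟨π.act w.prod (S j), Submodule.subset_span ⟨w, hw, j, hj, rfl⟩⟩

/-- `v_j` as an element of `V_{F,m}`. -/
def genVec (π : UBRep R V) (S : ℕ → V) (F : Set (PMorph R)) (m : ℕ) (j : ℕ) (hj : j < m) :
    wordSpan π S F m :=
  ⟨S j, Submodule.subset_span ⟨[], by simp [words], j, hj, by simp [π.act_one]⟩⟩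

variable (p : ℝ≥0∞) [Fact (1 ≤ p)]

/-- A matrix acting on `ℓ^p(n)`. -/
def matApply {n : ℕ} (M : Matrix (Fin n) (Fin n) ℂ) (f : ellp p n) : ellp p n :=
  WithLp.toLp p (M.mulVec (WithLp.ofLp f))

/-- The almost equivariant maps `Hom_{R,ℓ^p}(S, F, m, δ, σ_i)`: linear contractions
`T : V_{F,m} → ℓ^p(d_i)` such that, outside a set of at most `δ d_i` coordinates,
`T(φ₁⋯φ_k v_j)` is within `δ` of `σ_i(φ₁)⋯σ_i(φ_k) T(v_j)`. -/
def almostHom (Sig : SoficApprox R) (π : UBRep R V) (S : ℕ → V) (F : Set (PMorph R)) (m : ℕ)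
    (δ : ℝ) (i : ℕ) : Set (wordSpan π S F m →L[ℂ] ellp p (Sig.d i)) :=
  {T | ‖T‖ ≤ 1 ∧ ∃ A : Finset (Fin (Sig.d i)), (1 - δ) * Sig.d i ≤ A.card ∧
    ∀ (w : List (PMorph R)) (hw : w ∈ words F m) (j : ℕ) (hj : j < m),
      ‖cut A (T (wordVec π S F m w hw j hj) -
        matApply p (w.map fun φ => Sig.σ i (vv φ)).prod (T (genVec π S F m j hj)))‖ < δ}

variable {p} in
/-- `α_S(T)(j) = T(v_j)` for the first `m` indices `j`, and `0` for the others. -/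
def alphaS (π : UBRep R V) (S : ℕ → V) (F : Set (PMorph R)) (m : ℕ) {n : ℕ}
    (T : wordSpan π S F m →L[ℂ] ellp p n) : ellInfty (ellp p n) :=
  ⟨fun j => if hj : j < m then T (genVec π S F m j hj) else 0, by
    refine Memℓp.of_exponent_ge (memℓp_zero ?_) (zero_le (a := ∞))
    refine (Set.finite_Iio m).subset ?_
    intro j hj
    by_contra h
    exact hj (dif_neg h)⟩

/-- `limsup_i (1/d_i) d_ε(α_S(Hom_{R,ℓ^p}(S, F, m, δ, σ_i)), ρ_{p,d_i})`. -/
def fdimLocal (Sig : SoficApprox R) (π : UBRep R V) (S : ℕ → V) (ρ : ProductNorm)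
    (F : Set (PMorph R)) (m : ℕ) (δ ε : ℝ) : ℝ≥0∞ :=
  limsup (fun i => epsDim ρ ε (alphaS π S F m '' almostHom p Sig π S F m δ i) / Sig.d i) atTop

/-- The `ℓ^p`-dimension computed with the sequence `S`, the family `Φ` and the product norm `ρ`:
`sup_{ε > 0} liminf_{(F, m, δ)} limsup_i (1/d_i) d_ε(...)`, where `F` runs over the finite subsets
of `Φ` directed by inclusion, `m → ∞` and `δ → 0+`. -/
def fdim (Sig : SoficApprox R) (π : UBRep R V) (S : ℕ → V) (Φ : Set (PMorph R))
    (ρ : ProductNorm) : ℝ≥0∞ :=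
  ⨆ (ε : ℝ) (_ : 0 < ε),
    liminf (fun t : Finset Φ × ℕ × ℝ =>
      fdimLocal p Sig π S ρ (Subtype.val '' (t.1 : Set Φ)) t.2.1 t.2.2 ε)
      (atTop ×ˢ (atTop ×ˢ 𝓝[>] (0 : ℝ)))

end Dimension

end LpDim

end

set_option linter.unusedSectionVars false

/-! Almost equivariant maps on `V` pull back to `W` along `T`. Such a map `T₁` lives only on a
finite-dimensional span of words, so `T`, restricted to a word span of `W`, is first perturbed to a
map `θ` whose values are combinations of words applied to `SV`; dividing `T₁ ∘ θ` by `b = ‖T‖ + 1`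
gives a contraction `T₂` which is almost equivariant on `W`. As `T` has dense image, finitely many
vectors `SV j` are close to `T (x j)`, with `x j` a combination of words applied to `SW`. Hence `T₁
(SV j)` is close to `b • T₂ (x j)`, which up to a small error is a linear function of the values of
`T₂` on `SW`: replace each word by its matrices. The remaining indices do not matter, because a
product norm neglects tails. So one linear map carries every subspace that almost contains the
sequences coming from `W` to one that almost contains those coming from `V`, and dimension cannot
grow (`epsDim_le_epsDim`, `exists_eventually_fdimLocal_le`).

The difficulty is that `ΦV` and `ΦW` are unrelated: `T₁` is almost equivariant for words in `ΦV`,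
while `T₂` has to be so for words in `ΦW`. Every partial morphism is therefore approximated by
integral combinations of words in a given generating family, simultaneously for its action on
finitely many vectors and for its matrices (`approximable_pairOf`). Matrix errors are measured by
the proportion of nonzero rows rather than by a norm: a matrix with few nonzero rows sends every
vector of `ℓ^p` to one supported on few coordinates, which almost equivariance ignores, whatever `p`
is. The axioms of a sofic approximation control only `‖·‖₂`, but for integer matrices a small `‖·‖₂`
forces few nonzero rows (`card_rowSupp_le_matNorm2`). This is why the combinations are integral.

The approximable pairs are closed under sums, products and exhaustion of the domain in measure.
Hence the approximable sets form a `σ`-algebra, which contains all measurable sets because the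
translates of `𝒫` generate; and the graphing cuts a partial morphism into countably many pieces on
which it agrees with words. -/

namespace LpDim

/-! ### Nonzero rows of matrices -/

section Rows

variable {n : ℕ}

open Classical in
/-- The set of nonzero rows of a matrix. -/
noncomputable def rowSupp (M : Matrix (Fin n) (Fin n) ℂ) : Finset (Fin n) :=
  Finset.univ.filter fun r => M r ≠ 0

theorem mem_rowSupp {M : Matrix (Fin n) (Fin n) ℂ} {r : Fin n} : r ∈ rowSupp M ↔ M r ≠ 0 := by
  simp [rowSupp]

theorem card_rowSupp_add (M N : Matrix (Fin n) (Fin n) ℂ) :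
    (rowSupp (M + N)).card ≤ (rowSupp M).card + (rowSupp N).card := by
  classical
  refine (Finset.card_le_card ?_).trans (Finset.card_union_le _ _)
  intro r hr
  rw [Finset.mem_union, mem_rowSupp, mem_rowSupp]
  rw [mem_rowSupp] at hr
  by_contra! h
  refine hr (funext fun s => ?_)
  have h1 : M r s = 0 := congrFun h.1 s
  have h2 : N r s = 0 := congrFun h.2 s
  rw [Matrix.add_apply, h1, h2, add_zero, Pi.zero_apply]

theorem rowSupp_neg (M : Matrix (Fin n) (Fin n) ℂ) : rowSupp (-M) = rowSupp M := by
  ext r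
  rw [mem_rowSupp, mem_rowSupp]
  exact neg_ne_zero

theorem rowSupp_zero : rowSupp (0 : Matrix (Fin n) (Fin n) ℂ) = ∅ := by
  ext r
  simp only [mem_rowSupp, Finset.notMem_empty, iff_false, not_not]
  rfl

theorem rowSupp_mul_subset (M N : Matrix (Fin n) (Fin n) ℂ) : rowSupp (M * N) ⊆ rowSupp M := by
  intro r hr
  rw [mem_rowSupp] at hr ⊢
  intro h
  apply hr
  ext s
  simp [Matrix.mul_apply, h]

theorem card_rowSupp_mul_le (M N : Matrix (Fin n) (Fin n) ℂ) :
    (rowSupp (M * N)).card ≤ (rowSupp M).card :=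
  Finset.card_le_card (rowSupp_mul_subset M N)

/-- Left multiplication by `M` increases the number of nonzero rows at most by the factor `c`. -/
def RowBounded (c : ℕ) (M : Matrix (Fin n) (Fin n) ℂ) : Prop :=
  ∀ N : Matrix (Fin n) (Fin n) ℂ, (rowSupp (M * N)).card ≤ c * (rowSupp N).card

theorem RowBounded.add {c c' : ℕ} {M M' : Matrix (Fin n) (Fin n) ℂ} (h : RowBounded c M)
    (h' : RowBounded c' M') : RowBounded (c + c') (M + M') := by
  intro N
  rw [Matrix.add_mul, add_mul]
  exact (card_rowSupp_add _ _).trans (add_le_add (h N) (h' N))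

theorem RowBounded.neg {c : ℕ} {M : Matrix (Fin n) (Fin n) ℂ} (h : RowBounded c M) :
    RowBounded c (-M) := by
  intro N
  rw [Matrix.neg_mul, rowSupp_neg]
  exact h N

theorem RowBounded.mul {c c' : ℕ} {M M' : Matrix (Fin n) (Fin n) ℂ} (h : RowBounded c M)
    (h' : RowBounded c' M') : RowBounded (c * c') (M * M') := by
  intro N
  rw [Matrix.mul_assoc, mul_assoc]
  exact (h _).trans (Nat.mul_le_mul_left c (h' N))

theorem rowBounded_zero : RowBounded 0 (0 : Matrix (Fin n) (Fin n) ℂ) := by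
  intro N
  rw [Matrix.zero_mul, rowSupp_zero]
  simp

theorem rowBounded_one : RowBounded 1 (1 : Matrix (Fin n) (Fin n) ℂ) := by
  intro N
  rw [Matrix.one_mul, one_mul]

theorem toMatrix_mul_row (e : Fin n ≃. Fin n) (N : Matrix (Fin n) (Fin n) ℂ) (r : Fin n)
    (h : ((e.toMatrix : Matrix (Fin n) (Fin n) ℂ) * N) r ≠ 0) : ∃ s ∈ e r, N s ≠ 0 := by
  rcases her : e r with _ | s
  · exact (h (by ext t; rw [PEquiv.toMatrix_mul_apply, her]; rfl)).elim
  · refine ⟨s, rfl, fun hs => h ?_⟩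
    ext t
    rw [PEquiv.toMatrix_mul_apply, her]
    exact congrFun hs t

/-- A nonzero row `r` of the product is a copy of the row `e r` of `N`, and distinct `r` copy
distinct rows. -/
theorem rowBounded_toMatrix (e : Fin n ≃. Fin n) :
    RowBounded 1 (e.toMatrix : Matrix (Fin n) (Fin n) ℂ) := by
  intro N
  rw [one_mul]
  have key : ∀ r ∈ rowSupp ((e.toMatrix : Matrix (Fin n) (Fin n) ℂ) * N),
      ∃ s ∈ e r, N s ≠ 0 := fun r hr => toMatrix_mul_row e N r (mem_rowSupp.1 hr)
  choose! g hg using key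
  refine Finset.card_le_card_of_injOn g (fun r hr => mem_rowSupp.2 (hg r hr).2) ?_
  intro r hr r' hr' h
  refine e.inj (hg r hr).1 ?_
  rw [h]
  exact (hg r' hr').1

/-- The matrices with integer entries. -/
noncomputable def intMatrices (n : ℕ) : Subring (Matrix (Fin n) (Fin n) ℂ) :=
  ((Int.castRingHom ℂ).mapMatrix (m := Fin n)).range

theorem toMatrix_mem_intMatrices (e : Fin n ≃. Fin n) :
    (e.toMatrix : Matrix (Fin n) (Fin n) ℂ) ∈ intMatrices n := by
  refine ⟨e.toMatrix, ?_⟩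
  ext r s
  simp [PEquiv.toMatrix_apply]

/-- A nonzero row of integers has an entry of modulus at least `1`, so it contributes at least `1`
to `Tr (M^* M)`, the sum of all `|M r s|²`. -/
theorem card_rowSupp_le_matNorm2 {M : Matrix (Fin n) (Fin n) ℂ} (hM : M ∈ intMatrices n) :
    ((rowSupp M).card : ℝ) ≤ n * matNorm2 M ^ 2 := by
  obtain ⟨Z, rfl⟩ := hM
  set M := (Int.castRingHom ℂ).mapMatrix Z with hMd
  have htr : (M.conjTranspose * M).trace.re = ∑ r, ∑ s, ‖M r s‖ ^ 2 := by
    rw [Finset.sum_comm]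
    simp only [Matrix.trace, Matrix.diag, Matrix.mul_apply, Matrix.conjTranspose_apply,
      Complex.re_sum]
    refine Finset.sum_congr rfl fun s _ => Finset.sum_congr rfl fun r _ => ?_
    rw [← Complex.normSq_eq_norm_sq, Complex.star_def, ← Complex.normSq_eq_conj_mul_self,
      Complex.ofReal_re]
  have hnn : 0 ≤ (M.conjTranspose * M).trace.re := by
    rw [htr]; positivity
  rcases Nat.eq_zero_or_pos n with rfl | hn
  · simp [Finset.eq_empty_of_isEmpty (rowSupp M)]
  have hn' : (0 : ℝ) < n := by exact_mod_cast hn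
  rw [matNorm2, Real.sq_sqrt (by positivity), mul_div_cancel₀ _ hn'.ne', htr]
  calc ((rowSupp M).card : ℝ) = ∑ r ∈ rowSupp M, 1 := by simp
    _ ≤ ∑ r ∈ rowSupp M, ∑ s, ‖M r s‖ ^ 2 := by
      refine Finset.sum_le_sum fun r hr => ?_
      obtain ⟨s, hs⟩ := Function.ne_iff.1 (mem_rowSupp.1 hr)
      refine le_trans ?_ (Finset.single_le_sum (f := fun s => ‖M r s‖ ^ 2)
        (fun _ _ => by positivity) (Finset.mem_univ s))
      have h1 : M r s = ((Z r s : ℤ) : ℂ) := by simp [hMd]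
      have h2 : Z r s ≠ 0 := by
        rintro h0
        exact hs (by rw [h1, h0]; simp)
      have h3 : (1 : ℝ) ≤ ‖M r s‖ := by
        rw [h1, Complex.norm_intCast]
        exact_mod_cast Int.one_le_abs h2
      exact one_le_pow₀ h3
    _ ≤ ∑ r, ∑ s, ‖M r s‖ ^ 2 :=
      Finset.sum_le_univ_sum_of_nonneg fun r => by positivity

/-- Through this, convergence of traces controls the number of rows occupied by a diagonal
projection. -/
theorem card_rowSupp_diagonal (s : Set (Fin n)) :
    ((rowSupp (Matrix.diagonal (s.indicator (1 : Fin n → ℂ)))).card : ℂ) =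
      (Matrix.diagonal (s.indicator (1 : Fin n → ℂ))).trace := by
  classical
  have : rowSupp (Matrix.diagonal (s.indicator (1 : Fin n → ℂ))) =
      Finset.univ.filter fun r => r ∈ s := by
    ext r
    simp only [mem_rowSupp, Finset.mem_filter, Finset.mem_univ, true_and]
    constructor
    · intro h
      by_contra hr
      apply h
      ext t
      simp only [Matrix.diagonal_apply, Pi.zero_apply]
      split_ifs <;> simp [hr]
    · intro hr h
      have := congrFun h r
      simp [hr] at this
  rw [this, Matrix.trace_diagonal, Finset.card_filter]
  push_cast
  refine Finset.sum_congr rfl fun r _ => ?_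
  by_cases h : r ∈ s <;> simp [h]

/-- The number of nonzero rows of `M i` is `o(d i)`. -/
def RowNegligible {d : ℕ → ℕ} (M : ∀ i, Matrix (Fin (d i)) (Fin (d i)) ℂ) : Prop :=
  ∀ η : ℝ, 0 < η → ∀ᶠ i in atTop, ((rowSupp (M i)).card : ℝ) ≤ η * d i

theorem rowNegligible_of_matNorm2 {d : ℕ → ℕ} {M : ∀ i, Matrix (Fin (d i)) (Fin (d i)) ℂ}
    (hi : ∀ i, M i ∈ intMatrices (d i)) (h : Tendsto (fun i => matNorm2 (M i)) atTop (𝓝 0)) :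
    RowNegligible M := by
  intro η hη
  have h2 : Tendsto (fun i => matNorm2 (M i) ^ 2) atTop (𝓝 0) := by simpa using h.pow 2
  filter_upwards [h2.eventually (gt_mem_nhds hη)] with i hlt
  refine (card_rowSupp_le_matNorm2 (hi i)).trans ?_
  rw [mul_comm]
  gcongr

end Rows

/-! ### Cutting down vectors -/

section Cut

variable {p : ℝ≥0∞} [Fact (1 ≤ p)] {n : ℕ}

theorem cut_apply (C : Finset (Fin n)) (f : ellp p n) (k : Fin n) [Decidable (k ∈ C)] :
    cut C f k = if k ∈ C then f k else 0 := by
  simp only [cut]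
  congr

theorem cut_add (C : Finset (Fin n)) (f g : ellp p n) : cut C (f + g) = cut C f + cut C g := by
  classical
  ext k
  simp only [cut_apply, PiLp.add_apply]
  split_ifs <;> simp

theorem cut_smul (C : Finset (Fin n)) (c : ℂ) (f : ellp p n) : cut C (c • f) = c • cut C f := by
  classical
  ext k
  simp only [cut_apply, PiLp.smul_apply]
  split_ifs <;> simp

theorem norm_le_of_apply_le (hp : p ≠ ∞) {f g : ellp p n} (h : ∀ k, ‖f k‖ ≤ ‖g k‖) :
    ‖f‖ ≤ ‖g‖ := by
  have h0 : 0 < p.toReal := ENNReal.toReal_pos (zero_lt_one.trans_le (Fact.out : 1 ≤ p)).ne' hp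
  rw [PiLp.norm_eq_sum h0, PiLp.norm_eq_sum h0]
  gcongr with k
  exact h k

theorem norm_cut_mono (hp : p ≠ ∞) {C D : Finset (Fin n)} (h : C ⊆ D) (f : ellp p n) :
    ‖cut C f‖ ≤ ‖cut D f‖ := by
  classical
  refine norm_le_of_apply_le hp fun k => ?_
  rw [cut_apply, cut_apply]
  by_cases hk : k ∈ C
  · simp [hk, h hk]
  · simp [hk]

theorem matApply_add (M : Matrix (Fin n) (Fin n) ℂ) (f g : ellp p n) :
    matApply p M (f + g) = matApply p M f + matApply p M g := by
  simp [matApply, Matrix.mulVec_add]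

theorem matApply_smul (M : Matrix (Fin n) (Fin n) ℂ) (c : ℂ) (f : ellp p n) :
    matApply p M (c • f) = c • matApply p M f := by
  simp [matApply, Matrix.mulVec_smul]

theorem matApply_zero (M : Matrix (Fin n) (Fin n) ℂ) : matApply p M 0 = 0 := by
  simp [matApply]

theorem add_matApply (M N : Matrix (Fin n) (Fin n) ℂ) (f : ellp p n) :
    matApply p (M + N) f = matApply p M f + matApply p N f := by
  simp [matApply, Matrix.add_mulVec]

theorem neg_matApply (M : Matrix (Fin n) (Fin n) ℂ) (f : ellp p n) :
    matApply p (-M) f = -matApply p M f := by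
  simp [matApply, Matrix.neg_mulVec]

theorem sub_matApply (M N : Matrix (Fin n) (Fin n) ℂ) (f : ellp p n) :
    matApply p (M - N) f = matApply p M f - matApply p N f := by
  rw [sub_eq_add_neg, add_matApply, neg_matApply, sub_eq_add_neg]

theorem zero_matApply (f : ellp p n) : matApply p (0 : Matrix (Fin n) (Fin n) ℂ) f = 0 := by
  simp [matApply]

theorem mul_matApply (M N : Matrix (Fin n) (Fin n) ℂ) (f : ellp p n) :
    matApply p (M * N) f = matApply p M (matApply p N f) := by
  simp [matApply, Matrix.mulVec_mulVec]

theorem cut_matApply_eq_zero {C : Finset (Fin n)} {M : Matrix (Fin n) (Fin n) ℂ}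
    (h : Disjoint C (rowSupp M)) (f : ellp p n) : cut C (matApply p M f) = 0 := by
  classical
  ext k
  rw [cut_apply]
  split_ifs with hk
  · have : M k = 0 := by
      by_contra h0
      exact Finset.disjoint_left.1 h hk (mem_rowSupp.2 h0)
    simp [matApply, Matrix.mulVec, this]
  · rfl

theorem toMatrix_matApply (e : Fin n ≃. Fin n) (f : ellp p n) (r : Fin n) :
    matApply p (e.toMatrix : Matrix (Fin n) (Fin n) ℂ) f r =
      Option.casesOn (e r) 0 fun s => f s := by
  have := PEquiv.toMatrix_mul_apply e r () (Matrix.of fun (k : Fin n) (_ : Unit) => f k)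
  simpa [matApply, Matrix.mulVec, dotProduct, Matrix.mul_apply] using this

/-- Discard the coordinates `r` with `e r` defined and outside `C`. By injectivity there are at most
`|Cᶜ|` of them, and the nonzero coordinates that remain are distinct coordinates of `cut C f`. -/
theorem exists_norm_cut_toMatrix_le (hp : p ≠ ∞) (e : Fin n ≃. Fin n) (C : Finset (Fin n)) :
    ∃ D : Finset (Fin n), Dᶜ.card ≤ Cᶜ.card ∧ ∀ f : ellp p n,
      ‖cut D (matApply p (e.toMatrix : Matrix (Fin n) (Fin n) ℂ) f)‖ ≤ ‖cut C f‖ := by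
  classical
  have h0 : 0 < p.toReal := ENNReal.toReal_pos (zero_lt_one.trans_le (Fact.out : 1 ≤ p)).ne' hp
  refine ⟨Finset.univ.filter fun r => ∀ s ∈ e r, s ∈ C, ?_, fun f => ?_⟩
  · have key : ∀ r ∈ (Finset.univ.filter fun r => ∀ s ∈ e r, s ∈ C)ᶜ, ∃ s ∈ e r, s ∉ C := by
      intro r hr
      simpa using hr
    choose! g hg using key
    refine Finset.card_le_card_of_injOn g (fun r hr => by simpa using (hg r hr).2) ?_
    intro r hr r' hr' h
    exact e.inj (hg r hr).1 (h ▸ (hg r' hr').1)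
  · set D := Finset.univ.filter fun r => ∀ s ∈ e r, s ∈ C with hD
    rw [PiLp.norm_eq_sum h0, PiLp.norm_eq_sum h0]
    gcongr ?_ ^ _
    set T : Finset (Fin n) := Finset.univ.filter fun r => (e r).isSome ∧ r ∈ D with hT
    have hz : ∀ r ∉ T, ‖cut D (matApply p (e.toMatrix : Matrix (Fin n) (Fin n) ℂ) f) r‖ ^
        p.toReal = 0 := by
      intro r hr
      have : cut D (matApply p (e.toMatrix : Matrix (Fin n) (Fin n) ℂ) f) r = 0 := by
        rw [cut_apply, toMatrix_matApply]
        split_ifs with hrD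
        · rcases her : e r with _ | s
          · rfl
          · exact (hr (by simp [hT, her, hrD])).elim
        · rfl
      rw [this, norm_zero, Real.zero_rpow h0.ne']
    rw [← Finset.sum_subset (Finset.subset_univ T) fun r _ hr => hz r hr]
    have key : ∀ r ∈ T, ∃ s ∈ e r, s ∈ C := by
      intro r hr
      simp only [hT, Finset.mem_filter, Finset.mem_univ, true_and, hD] at hr
      obtain ⟨s, hs⟩ := Option.isSome_iff_exists.1 hr.1
      exact ⟨s, hs, hr.2 s hs⟩
    choose! g hg using key
    have hinj : Set.InjOn g T := fun r hr r' hr' h => e.inj (hg r hr).1 (h ▸ (hg r' hr').1)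
    calc ∑ r ∈ T, ‖cut D (matApply p (e.toMatrix : Matrix (Fin n) (Fin n) ℂ) f) r‖ ^ p.toReal
        = ∑ r ∈ T, ‖cut C f (g r)‖ ^ p.toReal := by
          refine Finset.sum_congr rfl fun r hr => ?_
          have hr1 : e r = some (g r) := (hg r hr).1
          have hr2 : r ∈ D := (Finset.mem_filter.1 hr).2.2
          rw [cut_apply, cut_apply, if_pos hr2, if_pos (hg r hr).2, toMatrix_matApply, hr1]
      _ = ∑ s ∈ T.image g, ‖cut C f s‖ ^ p.toReal := by rw [Finset.sum_image hinj]
      _ ≤ ∑ s, ‖cut C f s‖ ^ p.toReal :=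
          Finset.sum_le_univ_sum_of_nonneg fun s => by positivity

theorem exists_pequiv_list_prod (l : List (Matrix (Fin n) (Fin n) ℂ))
    (h : ∀ M ∈ l, ∃ e : Fin n ≃. Fin n, M = e.toMatrix) :
    ∃ e : Fin n ≃. Fin n, l.prod = e.toMatrix := by
  induction l with
  | nil => exact ⟨PEquiv.refl _, by simp [PEquiv.toMatrix_refl]⟩
  | cons M l ih =>
    obtain ⟨e, he⟩ := h M (by simp)
    obtain ⟨f, hf⟩ := ih fun N hN => h N (by simp [hN])
    exact ⟨e.trans f, by rw [List.prod_cons, he, hf, PEquiv.toMatrix_trans]⟩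

theorem card_le_iff_compl (κ : ℝ) (A : Finset (Fin n)) :
    (1 - κ) * n ≤ A.card ↔ (Aᶜ.card : ℝ) ≤ κ * n := by
  have := Finset.card_add_card_compl A
  rw [Fintype.card_fin] at this
  have h : (A.card : ℝ) + Aᶜ.card = n := by exact_mod_cast this
  constructor <;> intro h' <;> linarith

theorem card_compl_inter_le (A B : Finset (Fin n)) :
    ((A ∩ B)ᶜ.card : ℝ) ≤ Aᶜ.card + Bᶜ.card := by
  rw [Finset.compl_inter]
  exact_mod_cast Finset.card_union_le _ _

end Cut

/-! ### Operators of partial morphisms and traces of projections -/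

section Operators

variable {X : Type*} [MeasurableSpace X] {μ : Measure X} [StandardBorelSpace X] {R : MPRel X μ}

open PMorph

theorem inv_inv (φ : PMorph R) : φ.inv.inv = φ := rfl

theorem inv_one : (1 : PMorph R).inv = 1 := rfl

theorem inv_idOn {A : Set X} (hA : MeasurableSet A) : (idOn R A hA).inv = idOn R A hA := rfl

theorem mul_toPE (φ ψ : PMorph R) : (φ * ψ).toPE = ψ.toPE.trans φ.toPE := rfl

theorem idOn_toPE {A : Set X} (hA : MeasurableSet A) :
    (idOn R A hA).toPE = PartialEquiv.ofSet A := rfl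

theorem idOn_congr {A B : Set X} (h : A = B) (hA : MeasurableSet A) (hB : MeasurableSet B) :
    idOn R A hA = idOn R B hB := by
  subst h; rfl

theorem idOn_univ : idOn R Set.univ MeasurableSet.univ = 1 :=
  ext_toPE (PartialEquiv.ext (fun _ => rfl) (fun _ => rfl) rfl)

theorem idOn_mul_idOn {A B : Set X} (hA : MeasurableSet A) (hB : MeasurableSet B) :
    idOn R A hA * idOn R B hB = idOn R (A ∩ B) (hA.inter hB) := by
  refine ext_toPE (PartialEquiv.ext (fun _ => rfl) (fun _ => rfl) ?_)
  rw [mul_toPE, PartialEquiv.trans_source]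
  ext x
  simp [idOn_toPE, and_comm]

theorem mul_idOn_source_eq (φ : PMorph R) {A : Set X} (hA : MeasurableSet A) :
    (φ * idOn R A hA).toPE.source = A ∩ φ.toPE.source := by
  rw [mul_toPE, PartialEquiv.trans_source]
  ext x
  simp [idOn_toPE]

/-- Identities such as `w id_B w⁻¹ = id_{w(B)}` hold only up to the values off the domain, that is,
up to `≈`. Representations and sofic approximations do not see the difference. -/
theorem aeEq_of_eqOnSource {φ ψ : PMorph R} (h : φ.toPE ≈ ψ.toPE) : φ.AEEq ψ :=
  ae_of_all _ fun x => ⟨by rw [h.1], fun hx => h.2 hx⟩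

theorem vApply_congr {φ ψ : PMorph R} (h : φ.toPE ≈ ψ.toPE) (f : X × X → ℂ) :
    vApply φ f = vApply ψ f := by
  funext z
  have ht := PartialEquiv.EqOnSource.target_eq h
  unfold vApply
  by_cases hz : z.1 ∈ φ.toPE.target
  · rw [if_pos hz, if_pos (ht ▸ hz), PartialEquiv.EqOnSource.symm_eqOn h hz]
  · rw [if_neg hz, if_neg (ht ▸ hz)]

theorem opApply_add (x y : FormalSum R) (f : X × X → ℂ) :
    opApply (x + y) f = opApply x f + opApply y f := by
  funext z
  simp only [opApply, Pi.add_apply, MonoidAlgebra.coeff_add]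
  exact Finsupp.sum_add_index' (by simp) (by intros; ring)

theorem opApply_vv (φ : PMorph R) (f : X × X → ℂ) : opApply (vv φ) f = vApply φ f := by
  funext z
  simp only [opApply, vv, MonoidAlgebra.coeff_single]
  rw [Finsupp.sum_single_index (by simp), one_mul]

theorem opApply_sub (x y : FormalSum R) (f : X × X → ℂ) :
    opApply (x - y) f = opApply x f - opApply y f := by
  rw [eq_sub_iff_add_eq, ← opApply_add, sub_add_cancel]

theorem sameOp_of_eqOnSource {φ ψ : PMorph R} (h : φ.toPE ≈ ψ.toPE) : SameOp (vv φ) (vv ψ) := by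
  intro f _
  rw [opApply_vv, opApply_vv, vApply_congr h]

theorem vApply_idOn {A : Set X} (hA : MeasurableSet A) (f : X × X → ℂ) :
    vApply (idOn R A hA) f = fun z => A.indicator 1 z.1 * f z := by
  funext z
  unfold vApply
  rw [idOn_toPE]
  by_cases hz : z.1 ∈ A
  · simp [hz]
  · simp [hz]

theorem sameOp_idOn_union {A B : Set X} (hA : MeasurableSet A) (hB : MeasurableSet B)
    (h : Disjoint A B) :
    SameOp (vv (idOn R (A ∪ B) (hA.union hB))) (vv (idOn R A hA) + vv (idOn R B hB)) := by
  intro f _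
  rw [opApply_add, opApply_vv, opApply_vv, opApply_vv, vApply_idOn, vApply_idOn, vApply_idOn]
  refine Eventually.of_forall fun z => ?_
  simp only [Pi.add_apply]
  rw [Set.indicator_union_of_disjoint h, add_mul]

/-- By almost everywhere reflexivity the section over almost every `x` is `{x}` if `x ∈ A`, and it
is empty otherwise. -/
theorem mubar_diagonal [IsFiniteMeasure μ] {A : Set X} (hA : MeasurableSet A) :
    R.mubar {z | z.1 = z.2 ∧ z.1 ∈ A} = μ A := by
  have hm : MeasurableSet {z : X × X | z.1 = z.2 ∧ z.1 ∈ A} :=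
    measurableSet_diagonal.inter (measurable_fst hA)
  rw [MPRel.mubar, Measure.ofMeasurable_apply _ hm, ← lintegral_indicator_one hA]
  refine lintegral_congr_ae ?_
  filter_upwards [R.ae_refl] with x hx
  by_cases hxA : x ∈ A
  · have : {y | (x, y) ∈ {z : X × X | z.1 = z.2 ∧ z.1 ∈ A} ∩ R.rel} = {x} := by
      ext y
      simp only [Set.mem_inter_iff, Set.mem_ofPred_eq, Set.mem_singleton_iff]
      constructor
      · exact fun h => h.1.1.symm
      · rintro rfl
        exact ⟨⟨rfl, hxA⟩, hx⟩
    rw [this, Measure.count_singleton, Set.indicator_of_mem hxA, Pi.one_apply]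
  · have : {y | (x, y) ∈ {z : X × X | z.1 = z.2 ∧ z.1 ∈ A} ∩ R.rel} = ∅ := by
      ext y
      simp [hxA]
    rw [this, Set.indicator_of_notMem hxA, measure_empty]

theorem tau_eq_of_opApply [IsFiniteMeasure μ] {A : Set X} (hA : MeasurableSet A)
    {x : FormalSum R} (h : opApply x (diagFun X) = fun z => A.indicator 1 z.1 * diagFun X z) :
    tau x = (μ.real A : ℂ) := by
  have hm : MeasurableSet {z : X × X | z.1 = z.2 ∧ z.1 ∈ A} :=
    measurableSet_diagonal.inter (measurable_fst hA)
  have : ∀ z : X × X, opApply x (diagFun X) z * conj (diagFun X z) =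
      ({z : X × X | z.1 = z.2 ∧ z.1 ∈ A}.indicator 1 z : ℂ) := by
    intro z
    rw [h]
    classical
    simp only [diagFun, Set.indicator_apply, Set.mem_ofPred_eq]
    by_cases h1 : z.1 = z.2
    · by_cases h2 : z.1 ∈ A
      · simp only [if_pos h1, if_pos h2, if_pos (And.intro h1 h2), Pi.one_apply, map_one, mul_one]
      · simp only [if_neg h2, zero_mul, if_neg fun h : z.1 = z.2 ∧ z.1 ∈ A => h2 h.2]
    · simp only [if_neg h1, mul_zero, zero_mul, if_neg fun h : z.1 = z.2 ∧ z.1 ∈ A => h1 h.1]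
  unfold tau
  simp only [this]
  rw [integral_indicator hm]
  simp [measureReal_def, mubar_diagonal hA]

theorem tau_idOn [IsFiniteMeasure μ] {A : Set X} (hA : MeasurableSet A) :
    tau (vv (idOn R A hA)) = (μ.real A : ℂ) :=
  tau_eq_of_opApply hA (by rw [opApply_vv, vApply_idOn])

theorem adj_vv (φ : PMorph R) : adj (vv φ) = vv φ.inv := by
  simp only [adj, vv, MonoidAlgebra.coeff_single]
  rw [Finsupp.sum_single_index (by simp), map_one]

theorem adj_sub (x y : FormalSum R) : adj (x - y) = adj x - adj y := by
  rw [eq_sub_iff_add_eq]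
  have h : ∀ a b : FormalSum R, adj (a + b) = adj a + adj b := by
    intro a b
    simp only [adj, MonoidAlgebra.coeff_add]
    exact Finsupp.sum_add_index' (by simp) (by intros; simp)
  rw [← h, sub_add_cancel]

theorem vv_mul_vv (φ ψ : PMorph R) : vv φ * vv ψ = vv (φ * ψ) := by
  simp [vv, MonoidAlgebra.single_mul_single]

/-- The difference acts as the projection `χ_{A \ B}`. This translates smallness in measure into the
hypothesis of the continuity axiom `act_tendsto`. -/
theorem norm2_idOn_sub [IsFiniteMeasure μ] {A B : Set X} (hA : MeasurableSet A)
    (hB : MeasurableSet B) (h : B ⊆ A) :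
    norm2 (vv (idOn R A hA) - vv (idOn R B hB)) = Real.sqrt (μ.real (A \ B)) := by
  rw [norm2, tau_eq_of_opApply (hA.diff hB), Complex.ofReal_re]
  rw [adj_sub, adj_vv, adj_vv, inv_idOn, inv_idOn, sub_mul, mul_sub, mul_sub]
  simp only [vv_mul_vv, idOn_mul_idOn, opApply_sub, opApply_vv, vApply_idOn]
  funext z
  simp only [Pi.sub_apply, Set.inter_self]
  have hAB : A ∩ B = B := Set.inter_eq_right.2 h
  have hBA : B ∩ A = B := Set.inter_eq_left.2 h
  rw [hAB, hBA]
  by_cases h1 : z.1 ∈ A <;> by_cases h2 : z.1 ∈ B <;> simp [h1, h2]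
  exact (h1 (h h2)).elim

end Operators

/-! ### Sofic approximations of partial morphisms up to few rows -/

section Sofic

variable {X : Type*} [MeasurableSpace X] {μ : Measure X} [StandardBorelSpace X] {R : MPRel X μ}
  (Sig : SoficApprox R)

open PMorph

theorem sigma_mem_intMatrices (i : ℕ) (φ : PMorph R) : Sig.σ i (vv φ) ∈ intMatrices (Sig.d i) := by
  obtain ⟨e, he⟩ := Sig.map_pmorph i φ
  rw [he]
  exact toMatrix_mem_intMatrices e

theorem rowBounded_sigma (i : ℕ) (φ : PMorph R) : RowBounded 1 (Sig.σ i (vv φ)) := by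
  obtain ⟨e, he⟩ := Sig.map_pmorph i φ
  rw [he]
  exact rowBounded_toMatrix e

theorem rowNegligible_mul (φ ψ : PMorph R) :
    RowNegligible fun i => Sig.σ i (vv (φ * ψ)) - Sig.σ i (vv φ) * Sig.σ i (vv ψ) := by
  refine rowNegligible_of_matNorm2 (fun i => ?_) ?_
  · exact sub_mem (sigma_mem_intMatrices Sig i _)
      (mul_mem (sigma_mem_intMatrices Sig i _) (sigma_mem_intMatrices Sig i _))
  · simpa only [vv_mul_vv] using Sig.mul (vv φ) (vv ψ)

theorem rowNegligible_idOn_union {A B : Set X} (hA : MeasurableSet A) (hB : MeasurableSet B)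
    (h : Disjoint A B) :
    RowNegligible fun i => Sig.σ i (vv (idOn R (A ∪ B) (hA.union hB))) -
      Sig.σ i (vv (idOn R A hA)) - Sig.σ i (vv (idOn R B hB)) := by
  refine rowNegligible_of_matNorm2 (fun i => ?_) ?_
  · exact sub_mem (sub_mem (sigma_mem_intMatrices Sig i _) (sigma_mem_intMatrices Sig i _))
      (sigma_mem_intMatrices Sig i _)
  -- The two sides of `id_{A ∪ B} = id_A + id_B` are different formal sums but the same operator,
  -- hence `congr_op` before additivity.
  · simp only [Sig.congr_op _ _ _ (sameOp_idOn_union hA hB h)]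
    exact Sig.add _ _

/-- The matrices are diagonal projections, so their normalized traces are exactly the proportions of
nonzero rows, and these converge to `τ(χ_A) = μ(A)`. -/
theorem eventually_card_rowSupp_idOn [IsFiniteMeasure μ] {A : Set X} (hA : MeasurableSet A) {η : ℝ}
    (hη : μ.real A < η) :
    ∀ᶠ i in atTop, ((rowSupp (Sig.σ i (vv (idOn R A hA)))).card : ℝ) ≤ η * Sig.d i := by
  have h := Sig.trace (vv (idOn R A hA))
  rw [tau_idOn hA] at h
  have h2 := (Complex.continuous_re.tendsto _).comp h
  rw [Complex.ofReal_re] at h2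
  filter_upwards [h2.eventually (gt_mem_nhds hη)] with i hi
  obtain ⟨s, hs⟩ := Sig.map_proj i A hA
  simp only [Function.comp_apply] at hi
  rw [hs] at hi ⊢
  rw [← card_rowSupp_diagonal, ← Complex.ofReal_natCast, ← Complex.ofReal_natCast,
    ← Complex.ofReal_div, Complex.ofReal_re] at hi
  rcases Nat.eq_zero_or_pos (Sig.d i) with h0 | h0
  · have := Finset.card_le_univ
      (rowSupp (Matrix.diagonal (s.indicator (1 : Fin (Sig.d i) → ℂ))))
    rw [Fintype.card_fin] at this
    rw [Nat.le_zero.1 (this.trans h0.le), h0]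
    simp
  · have h0' : (0 : ℝ) < Sig.d i := by exact_mod_cast h0
    exact ((div_lt_iff₀ h0').1 hi).le

end Sofic

/-! ### Pairs of an operator on `V` and a sequence of matrices -/

section Pairs

variable {X : Type*} [MeasurableSpace X] {μ : Measure X} [StandardBorelSpace X] {R : MPRel X μ}
  (Sig : SoficApprox R) {V : Type*} [NormedAddCommGroup V] [NormedSpace ℂ V]

/-- Pairs of an operator on `V` and a sequence of matrices of the sizes `d_i`. -/
abbrev OpPair (V : Type*) [NormedAddCommGroup V] [NormedSpace ℂ V] :=
  (V →L[ℂ] V) × (∀ i, Matrix (Fin (Sig.d i)) (Fin (Sig.d i)) ℂ)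

variable (π : UBRep R V)

/-- The pair given by the action of `φ` on `V` and by its sofic approximations. -/
noncomputable def pairOf (φ : PMorph R) : OpPair Sig V := (π.act φ, fun i => Sig.σ i (vv φ))

theorem pairOf_congr {φ ψ : PMorph R} (h : φ.toPE ≈ ψ.toPE) :
    pairOf Sig π φ = pairOf Sig π ψ := by
  refine Prod.ext (π.act_congr _ _ (aeEq_of_eqOnSource h)) (funext fun i => ?_)
  exact Sig.congr_op i _ _ (sameOp_of_eqOnSource h)

/-- The integral combinations of words in `Φ`. -/
noncomputable def wordRing (Φ : Set (PMorph R)) : Subring (OpPair Sig V) :=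
  Subring.closure (pairOf Sig π '' letters Φ)

/-- Two pairs are `η`-near on `Y` if the operators are `η`-close on `Y` and if the matrices
eventually agree on all but a fraction `η` of the rows. -/
def Near (Y : Set V) (η : ℝ) (a b : OpPair Sig V) : Prop :=
  (∀ y ∈ Y, ‖a.1 y - b.1 y‖ < η) ∧
    ∀ᶠ i in atTop, ((rowSupp (a.2 i - b.2 i)).card : ℝ) ≤ η * Sig.d i

variable {Sig}

theorem Near.refl (Y : Set V) {η : ℝ} (hη : 0 < η) (a : OpPair Sig V) : Near Sig Y η a a := by
  refine ⟨fun y _ => by simpa using hη, Eventually.of_forall fun i => ?_⟩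
  rw [sub_self, rowSupp_zero]
  simp only [Finset.card_empty, Nat.cast_zero]
  positivity

theorem Near.trans {Y : Set V} {η η' : ℝ} {a b c : OpPair Sig V} (h : Near Sig Y η a b)
    (h' : Near Sig Y η' b c) : Near Sig Y (η + η') a c := by
  refine ⟨fun y hy => ?_, ?_⟩
  · calc ‖a.1 y - c.1 y‖ = ‖(a.1 y - b.1 y) + (b.1 y - c.1 y)‖ := by congr 1; abel
      _ ≤ ‖a.1 y - b.1 y‖ + ‖b.1 y - c.1 y‖ := norm_add_le _ _
      _ < η + η' := add_lt_add (h.1 y hy) (h'.1 y hy)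
  · filter_upwards [h.2, h'.2] with i h1 h2
    have h3 := card_rowSupp_add (a.2 i - b.2 i) (b.2 i - c.2 i)
    rw [sub_add_sub_cancel] at h3
    have h4 : ((rowSupp (a.2 i - c.2 i)).card : ℝ) ≤
        (rowSupp (a.2 i - b.2 i)).card + (rowSupp (b.2 i - c.2 i)).card := by exact_mod_cast h3
    linarith

theorem Near.add {Y : Set V} {η η' : ℝ} {a b a' b' : OpPair Sig V} (h : Near Sig Y η a b)
    (h' : Near Sig Y η' a' b') : Near Sig Y (η + η') (a + a') (b + b') := by
  refine ⟨fun y hy => ?_, ?_⟩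
  · calc ‖(a + a').1 y - (b + b').1 y‖ = ‖(a.1 y - b.1 y) + (a'.1 y - b'.1 y)‖ := by
          simp only [Prod.fst_add, _root_.add_apply]; congr 1; abel
      _ ≤ ‖a.1 y - b.1 y‖ + ‖a'.1 y - b'.1 y‖ := norm_add_le _ _
      _ < η + η' := add_lt_add (h.1 y hy) (h'.1 y hy)
  · filter_upwards [h.2, h'.2] with i h1 h2
    have h3 := card_rowSupp_add (a.2 i - b.2 i) (a'.2 i - b'.2 i)
    have h5 : (a.2 i - b.2 i) + (a'.2 i - b'.2 i) = (a + a').2 i - (b + b').2 i := by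
      simp only [Prod.snd_add, Pi.add_apply]; abel
    rw [h5] at h3
    have h4 : ((rowSupp ((a + a').2 i - (b + b').2 i)).card : ℝ) ≤
        (rowSupp (a.2 i - b.2 i)).card + (rowSupp (a'.2 i - b'.2 i)).card := by exact_mod_cast h3
    linarith

theorem Near.neg {Y : Set V} {η : ℝ} {a b : OpPair Sig V} (h : Near Sig Y η a b) :
    Near Sig Y η (-a) (-b) := by
  refine ⟨fun y hy => ?_, ?_⟩
  · have := h.1 y hy
    rw [← norm_neg] at this
    have e : (-a).1 y - (-b).1 y = -(a.1 y - b.1 y) := by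
      change -(a.1 y) - -(b.1 y) = _
      abel
    rwa [e]
  · filter_upwards [h.2] with i h1
    rw [← rowSupp_neg] at h1
    have e : (-a).2 i - (-b).2 i = -(a.2 i - b.2 i) := by
      change -(a.2 i) - -(b.2 i) = _
      abel
    rwa [e]

theorem near_of_rowNegligible {Y : Set V} {η : ℝ} (hη : 0 < η) {a b : OpPair Sig V}
    (h : a.1 = b.1) (h' : RowNegligible fun i => a.2 i - b.2 i) : Near Sig Y η a b :=
  ⟨fun y _ => by simpa [h] using hη, h' η hη⟩

/-- The bound is uniform in `i`. It controls the error made in the right factor of a product, which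
gets multiplied by `z` from the left. -/
theorem exists_rowBounded_of_mem_wordRing {Φ : Set (PMorph R)} {z : OpPair Sig V}
    (hz : z ∈ wordRing Sig π Φ) : ∃ c : ℕ, ∀ i, RowBounded c (z.2 i) := by
  induction hz using Subring.closure_induction with
  | mem x hx =>
    obtain ⟨φ, -, rfl⟩ := hx
    exact ⟨1, fun i => rowBounded_sigma Sig i φ⟩
  | zero => exact ⟨0, fun i => rowBounded_zero⟩
  | one => exact ⟨1, fun i => rowBounded_one⟩
  | add x y _ _ hx hy =>
    obtain ⟨c, hc⟩ := hx
    obtain ⟨c', hc'⟩ := hy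
    exact ⟨c + c', fun i => (hc i).add (hc' i)⟩
  | neg x _ hx =>
    obtain ⟨c, hc⟩ := hx
    exact ⟨c, fun i => (hc i).neg⟩
  | mul x y _ _ hx hy =>
    obtain ⟨c, hc⟩ := hx
    obtain ⟨c', hc'⟩ := hy
    exact ⟨c * c', fun i => (hc i).mul (hc' i)⟩

/-- A pair can be approximated by integral combinations of words in `Φ`. -/
def Approximable (Φ : Set (PMorph R)) (a : OpPair Sig V) : Prop :=
  ∀ Y : Set V, Y.Finite → ∀ η : ℝ, 0 < η → ∃ z ∈ wordRing Sig π Φ, Near Sig Y η a z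

variable {π} {Φ : Set (PMorph R)}

theorem approximable_of_mem {a : OpPair Sig V} (ha : a ∈ wordRing Sig π Φ) :
    Approximable π Φ a :=
  fun Y _ _ hη => ⟨a, ha, Near.refl Y hη a⟩

theorem approximable_of_near {a : OpPair Sig V}
    (h : ∀ Y : Set V, Y.Finite → ∀ η : ℝ, 0 < η → ∃ b, Approximable π Φ b ∧ Near Sig Y η a b) :
    Approximable π Φ a := by
  intro Y hY η hη
  obtain ⟨b, hb, hab⟩ := h Y hY (η / 2) (by positivity)
  obtain ⟨z, hz, hbz⟩ := hb Y hY (η / 2) (by positivity)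
  exact ⟨z, hz, by simpa using hab.trans hbz⟩

theorem Approximable.of_rowNegligible {a b : OpPair Sig V} (hb : Approximable π Φ b)
    (h : a.1 = b.1) (h' : RowNegligible fun i => a.2 i - b.2 i) : Approximable π Φ a :=
  approximable_of_near fun _ _ _ hη => ⟨b, hb, near_of_rowNegligible hη h h'⟩

theorem Approximable.add {a b : OpPair Sig V} (ha : Approximable π Φ a)
    (hb : Approximable π Φ b) : Approximable π Φ (a + b) := by
  intro Y hY η hη
  obtain ⟨z, hz, haz⟩ := ha Y hY (η / 2) (by positivity)
  obtain ⟨z', hz', hbz⟩ := hb Y hY (η / 2) (by positivity)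
  exact ⟨z + z', add_mem hz hz', by simpa using haz.add hbz⟩

theorem Approximable.neg {a : OpPair Sig V} (ha : Approximable π Φ a) :
    Approximable π Φ (-a) := by
  intro Y hY η hη
  obtain ⟨z, hz, haz⟩ := ha Y hY η hη
  exact ⟨-z, neg_mem hz, haz.neg⟩

theorem Approximable.sub {a b : OpPair Sig V} (ha : Approximable π Φ a)
    (hb : Approximable π Φ b) : Approximable π Φ (a - b) := by
  rw [sub_eq_add_neg]
  exact ha.add hb.neg

/-- Write `ab - zz' = (a - z)b + z(b - z')`. The pair `z` must be chosen first, close to `a` on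
`b(Y)`, since the accuracy needed for `z'` depends on `z`. -/
theorem Approximable.mul {a b : OpPair Sig V} (ha : Approximable π Φ a)
    (hb : Approximable π Φ b) : Approximable π Φ (a * b) := by
  intro Y hY η hη
  obtain ⟨z, hz, haz⟩ := ha (b.1 '' Y) (hY.image _) (η / 2) (by positivity)
  obtain ⟨c, hc⟩ := exists_rowBounded_of_mem_wordRing π hz
  -- One constant dominates both the operator norm of `z` and its row growth; the `+ 1` makes it
  -- positive.
  set K : ℝ := ‖z.1‖ + c + 1 with hK
  have hK0 : 0 < K := by positivity
  obtain ⟨z', hz', hbz⟩ := hb Y hY (η / 2 / K) (by positivity)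
  refine ⟨z * z', mul_mem hz hz', fun y hy => ?_, ?_⟩
  · have h1 := haz.1 (b.1 y) ⟨y, hy, rfl⟩
    have h2 := hbz.1 y hy
    have h3 : ‖z.1 (b.1 y - z'.1 y)‖ ≤ K * (η / 2 / K) := by
      refine (z.1.le_opNorm _).trans ?_
      gcongr
      have : (0 : ℝ) ≤ c := by positivity
      linarith
    rw [mul_div_cancel₀ _ hK0.ne'] at h3
    calc ‖(a * b).1 y - (z * z').1 y‖
        = ‖(a.1 (b.1 y) - z.1 (b.1 y)) + z.1 (b.1 y - z'.1 y)‖ := by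
          rw [map_sub, sub_add_sub_cancel]; rfl
      _ ≤ ‖a.1 (b.1 y) - z.1 (b.1 y)‖ + ‖z.1 (b.1 y - z'.1 y)‖ := norm_add_le _ _
      _ < η := by linarith
  · filter_upwards [haz.2, hbz.2] with i h1 h2
    have h3 := card_rowSupp_add ((a.2 i - z.2 i) * b.2 i) (z.2 i * (b.2 i - z'.2 i))
    have h4 := card_rowSupp_mul_le (a.2 i - z.2 i) (b.2 i)
    have h5 := hc i (b.2 i - z'.2 i)
    have h6 : (a * b).2 i - (z * z').2 i =
        (a.2 i - z.2 i) * b.2 i + z.2 i * (b.2 i - z'.2 i) := by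
      rw [sub_mul, mul_sub, sub_add_sub_cancel]; rfl
    rw [h6]
    have h7 : ((rowSupp ((a.2 i - z.2 i) * b.2 i + z.2 i * (b.2 i - z'.2 i))).card : ℝ) ≤
        (rowSupp (a.2 i - z.2 i)).card + c * (rowSupp (b.2 i - z'.2 i)).card := by
      exact_mod_cast h3.trans (add_le_add h4 h5)
    have h8 : (c : ℝ) * (rowSupp (b.2 i - z'.2 i)).card ≤ K * (η / 2 / K * Sig.d i) := by
      gcongr
      have := norm_nonneg z.1
      linarith
    rw [← mul_assoc, mul_div_cancel₀ _ hK0.ne'] at h8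
    linarith

open PMorph

theorem Approximable.pairOf_mul {φ ψ : PMorph R} (hφ : Approximable π Φ (pairOf Sig π φ))
    (hψ : Approximable π Φ (pairOf Sig π ψ)) : Approximable π Φ (pairOf Sig π (φ * ψ)) :=
  (hφ.mul hψ).of_rowNegligible
    (ContinuousLinearMap.ext fun v => (π.act_mul φ ψ v).symm) (rowNegligible_mul Sig φ ψ)

theorem approximable_pairOf_letter {φ : PMorph R} (h : φ ∈ letters Φ) :
    Approximable π Φ (pairOf Sig π φ) :=
  approximable_of_mem (Subring.subset_closure ⟨φ, h, rfl⟩)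

theorem Approximable.pairOf_idOn_compl {A : Set X} {hA : MeasurableSet A}
    (h : Approximable π Φ (pairOf Sig π (idOn R A hA))) :
    Approximable π Φ (pairOf Sig π (idOn R Aᶜ hA.compl)) := by
  have h1 : Approximable π Φ (pairOf Sig π (1 : PMorph R)) :=
    approximable_pairOf_letter (Or.inr (Or.inl rfl))
  have hun : idOn R (A ∪ Aᶜ) (hA.union hA.compl) = 1 := by
    rw [← idOn_univ]
    exact idOn_congr (Set.union_compl_self A) _ _
  have hd : Disjoint A Aᶜ := disjoint_compl_right
  refine (h1.sub h).of_rowNegligible ?_ ?_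
  · have := π.act_union A Aᶜ hA hA.compl hd
    rw [hun] at this
    exact eq_sub_of_add_eq' this.symm
  · have := rowNegligible_idOn_union Sig hA hA.compl hd
    rw [hun] at this
    intro η hη
    filter_upwards [this η hη] with i hi
    rw [← rowSupp_neg] at hi
    simpa only [pairOf, Prod.snd_sub, Pi.sub_apply, neg_sub] using hi

/-- Restricting `φ` to `E n` moves its action little on finitely many vectors, by continuity of the
representation. It changes about `μ(dom φ \ E n) · d_i` rows at most, since `σ_i(φ)` does not
increase the number of nonzero rows. -/
theorem approximable_of_tendsto [IsFiniteMeasure μ] {φ : PMorph R} {E : ℕ → Set X}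
    (hE : ∀ n, MeasurableSet (E n)) (hsub : ∀ n, E n ⊆ φ.toPE.source)
    (hlim : Tendsto (fun n => μ.real (φ.toPE.source \ E n)) atTop (𝓝 0))
    (h : ∀ n, Approximable π Φ (pairOf Sig π (φ * idOn R (E n) (hE n)))) :
    Approximable π Φ (pairOf Sig π φ) := by
  set A := φ.toPE.source with hA
  have hAm : MeasurableSet A := φ.measurableSet_source
  have hφ : pairOf Sig π (φ * idOn R A hAm) = pairOf Sig π φ := by
    refine pairOf_congr Sig π ⟨?_, fun x _ => rfl⟩
    rw [mul_idOn_source_eq, ← hA, Set.inter_self]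
  refine approximable_of_near fun Y hY η hη => ?_
  have hact : ∀ y, Tendsto (fun n => (pairOf Sig π (φ * idOn R (E n) (hE n))).1 y) atTop
      (𝓝 ((pairOf Sig π φ).1 y)) := by
    intro y
    have h1 : Tendsto (fun n => norm2 (vv (idOn R A hAm) - vv (idOn R (E n) (hE n)))) atTop
        (𝓝 0) := by
      simp only [norm2_idOn_sub hAm (hE _) (hsub _)]
      rw [← Real.sqrt_zero]
      exact (Real.continuous_sqrt.tendsto _).comp hlim
    have h2 := ((π.act φ).continuous.tendsto _).comp
      (π.act_tendsto (fun n => idOn R (E n) (hE n)) (idOn R A hAm) y h1)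
    rw [π.act_mul] at h2
    rw [← hφ]
    refine h2.congr fun n => ?_
    exact π.act_mul _ _ _
  have hev : ∀ᶠ n in atTop, (∀ y ∈ Y, ‖(pairOf Sig π φ).1 y -
      (pairOf Sig π (φ * idOn R (E n) (hE n))).1 y‖ < η) ∧ μ.real (A \ E n) < η / 4 := by
    refine Eventually.and ?_ (hlim.eventually (gt_mem_nhds (by positivity)))
    rw [hY.eventually_all]
    intro y _
    have := (tendsto_iff_norm_sub_tendsto_zero.1 (hact y)).eventually (gt_mem_nhds hη)
    filter_upwards [this] with n hn
    rwa [norm_sub_rev]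
  obtain ⟨n, hn1, hn2⟩ := hev.exists
  refine ⟨_, h n, hn1, ?_⟩
  have hη4 : 0 < η / 4 := by positivity
  have hdiff := hAm.diff (hE n)
  have hun : idOn R (E n ∪ A \ E n) ((hE n).union hdiff) = idOn R A hAm :=
    idOn_congr (Set.union_sdiff_cancel (hsub n)) _ _
  have e3 := rowNegligible_idOn_union Sig (hE n) hdiff Set.disjoint_sdiff_right (η / 4) hη4
  rw [hun] at e3
  filter_upwards [rowNegligible_mul Sig φ (idOn R A hAm) _ hη4,
    rowNegligible_mul Sig φ (idOn R (E n) (hE n)) _ hη4, e3,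
    eventually_card_rowSupp_idOn Sig hdiff hn2] with i h1 h2 h3 h4
  -- Four errors of size `η / 4`: two multiplicativity defects, one additivity defect, and the
  -- projection onto the missing part `A \ E n`.
  have hid : Sig.σ i (vv φ) - Sig.σ i (vv (φ * idOn R (E n) (hE n))) =
      ((Sig.σ i (vv (φ * idOn R A hAm)) - Sig.σ i (vv φ) * Sig.σ i (vv (idOn R A hAm))) +
        -(Sig.σ i (vv (φ * idOn R (E n) (hE n))) -
          Sig.σ i (vv φ) * Sig.σ i (vv (idOn R (E n) (hE n))))) +
      (Sig.σ i (vv φ) * (Sig.σ i (vv (idOn R A hAm)) - Sig.σ i (vv (idOn R (E n) (hE n))) -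
          Sig.σ i (vv (idOn R (A \ E n) hdiff))) +
        Sig.σ i (vv φ) * Sig.σ i (vv (idOn R (A \ E n) hdiff))) := by
    have : Sig.σ i (vv (φ * idOn R A hAm)) = Sig.σ i (vv φ) := congrFun (congrArg Prod.snd hφ) i
    rw [this]
    simp only [mul_sub]
    abel
  change ((rowSupp (Sig.σ i (vv φ) - Sig.σ i (vv (φ * idOn R (E n) (hE n))))).card : ℝ) ≤ _
  rw [hid]
  have k1 := (card_rowSupp_add _ _).trans (add_le_add
    ((card_rowSupp_add (Sig.σ i (vv (φ * idOn R A hAm)) -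
        Sig.σ i (vv φ) * Sig.σ i (vv (idOn R A hAm)))
      (-(Sig.σ i (vv (φ * idOn R (E n) (hE n))) -
        Sig.σ i (vv φ) * Sig.σ i (vv (idOn R (E n) (hE n)))))).trans
      (add_le_add le_rfl (by rw [rowSupp_neg])))
    ((card_rowSupp_add _ _).trans (add_le_add
      (rowBounded_sigma Sig i φ (Sig.σ i (vv (idOn R A hAm)) -
        Sig.σ i (vv (idOn R (E n) (hE n))) - Sig.σ i (vv (idOn R (A \ E n) hdiff))))
      (rowBounded_sigma Sig i φ (Sig.σ i (vv (idOn R (A \ E n) hdiff)))))))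
  refine (Nat.cast_le.2 k1).trans ?_
  push_cast
  linarith

end Pairs

/-! ### Partial morphisms are approximated by integral combinations of words -/

section Generating

variable {X : Type*} [MeasurableSpace X] {μ : Measure X} [StandardBorelSpace X] {R : MPRel X μ}

open PMorph

theorem letters_mono {F G : Set (PMorph R)} (h : F ⊆ G) : letters F ⊆ letters G := by
  rintro φ (h1 | h1 | h1)
  · exact Or.inl (h h1)
  · exact Or.inr (Or.inl h1)
  · exact Or.inr (Or.inr (h h1))

theorem inv_mem_letters {F : Set (PMorph R)} {φ : PMorph R} (h : φ ∈ letters F) :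
    φ.inv ∈ letters F := by
  rcases h with h1 | rfl | h1
  · exact Or.inr (Or.inr h1)
  · exact Or.inr (Or.inl inv_one)
  · exact Or.inl h1

theorem inv_mem_closure_letters {F : Set (PMorph R)} {φ : PMorph R}
    (h : φ ∈ Submonoid.closure (letters F)) : φ.inv ∈ Submonoid.closure (letters F) := by
  induction h using Submonoid.closure_induction with
  | mem x hx => exact Submonoid.subset_closure (inv_mem_letters hx)
  | one => exact one_mem _
  | mul x y _ _ hx hy => exact mul_mem hy hx

theorem countable_closure_letters {F : Set (PMorph R)} (hF : F.Countable) :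
    (Submonoid.closure (letters F) : Set (PMorph R)).Countable := by
  have hinj : Function.Injective (PMorph.inv : PMorph R → PMorph R) := fun φ ψ h => by
    have := congrArg PMorph.inv h
    rwa [LpDim.inv_inv, LpDim.inv_inv] at this
  have h1 : letters F = F ∪ ({1} ∪ PMorph.inv ⁻¹' F) := by
    ext φ
    simp only [letters, Set.mem_ofPred_eq, Set.mem_union, Set.mem_singleton_iff, Set.mem_preimage]
  have h2 : (letters F).Countable := by
    rw [h1]
    exact hF.union ((Set.countable_singleton _).union (hF.preimage_of_injOn hinj.injOn))
  have : Countable (letters F) := h2.to_subtype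
  rw [Submonoid.closure_eq_mrange]
  exact Set.countable_range _

/-- A chain of steps along the graphs, forwards or backwards, is the application of a product of
letters; backward steps use inverses. -/
theorem exists_mem_closure_letters_of_eqvGen {F : Set (PMorph R)} {a b : X}
    (h : Relation.EqvGen (fun a b => ∃ φ ∈ F, a ∈ φ.toPE.source ∧ φ.toPE a = b) a b) :
    ∃ ψ ∈ Submonoid.closure (letters F), a ∈ ψ.toPE.source ∧ ψ.toPE a = b := by
  induction h with
  | rel x y h =>
    obtain ⟨φ, hφ, h⟩ := h
    exact ⟨φ, Submonoid.subset_closure (Or.inl hφ), h⟩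
  | refl x => exact ⟨1, one_mem _, Set.mem_univ _, rfl⟩
  | symm x y _ ih =>
    obtain ⟨ψ, hψ, hx, rfl⟩ := ih
    exact ⟨ψ.inv, inv_mem_closure_letters hψ, ψ.toPE.map_source hx, ψ.toPE.left_inv hx⟩
  | trans x y z _ _ ih1 ih2 =>
    obtain ⟨ψ, hψ, hx, rfl⟩ := ih1
    obtain ⟨χ, hχ, hy, rfl⟩ := ih2
    refine ⟨χ * ψ, mul_mem hχ hψ, ?_, rfl⟩
    rw [mul_toPE, PartialEquiv.trans_source]
    exact ⟨hx, hy⟩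

/-- The maps are measurable only on their domains, so the equality set is formed inside the common
domain and then pushed forward to `X`. -/
theorem measurableSet_eq_on_source (φ ψ : PMorph R) :
    MeasurableSet {x | x ∈ φ.toPE.source ∩ ψ.toPE.source ∧ φ.toPE x = ψ.toPE x} := by
  set E := φ.toPE.source ∩ ψ.toPE.source with hE
  have hEm : MeasurableSet E := φ.measurableSet_source.inter ψ.measurableSet_source
  have key : ∀ χ : PMorph R, E ⊆ χ.toPE.source → Measurable fun x : E => χ.toPE x := by
    intro χ hχ s hs
    have : ((fun x : E => χ.toPE x) ⁻¹' s) =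
        Subtype.val ⁻¹' (χ.toPE.source ∩ χ.toPE ⁻¹' s) := by
      ext x
      simp only [Set.mem_preimage, Set.mem_inter_iff]
      exact ⟨fun h => ⟨hχ x.2, h⟩, fun h => h.2⟩
    rw [this]
    exact measurable_subtype_coe (χ.measurable_map s hs)
  have h2 : MeasurableSet {x : E | φ.toPE x = ψ.toPE x} :=
    measurableSet_eq_fun (key φ Set.inter_subset_left) (key ψ Set.inter_subset_right)
  convert (MeasurableEmbedding.subtype_coe hEm).measurableSet_image.2 h2 using 1
  ext x
  constructor
  · rintro ⟨h, h'⟩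
    exact ⟨⟨x, h⟩, h', rfl⟩
  · rintro ⟨y, hy, rfl⟩
    exact ⟨y.2, hy⟩

theorem tendsto_measureReal_diff [IsFiniteMeasure μ] {A : Set X} (hA : MeasurableSet A)
    {E : ℕ → Set X} (hE : ∀ n, MeasurableSet (E n)) (hmono : Monotone E)
    (h : μ (A \ ⋃ n, E n) = 0) : Tendsto (fun n => μ.real (A \ E n)) atTop (𝓝 0) := by
  have h1 : Tendsto (fun n => μ (A \ E n)) atTop (𝓝 (μ (⋂ n, A \ E n))) :=
    tendsto_measure_iInter_atTop (fun n => (hA.diff (hE n)).nullMeasurableSet)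
      (fun m n hmn => Set.sdiff_subset_sdiff_right (hmono hmn)) ⟨0, measure_ne_top _ _⟩
  rw [← Set.sdiff_iUnion, h] at h1
  rw [← ENNReal.toReal_zero]
  exact (ENNReal.tendsto_toReal ENNReal.zero_ne_top).comp h1

variable {Sig : SoficApprox R} {V : Type*} [NormedAddCommGroup V] [NormedSpace ℂ V]
  {π : UBRep R V} {Φ : Set (PMorph R)}

theorem approximable_pairOf_of_mem_closure {φ : PMorph R}
    (h : φ ∈ Submonoid.closure (letters Φ)) : Approximable π Φ (pairOf Sig π φ) := by
  induction h using Submonoid.closure_induction with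
  | mem x hx => exact approximable_pairOf_letter hx
  | one => exact approximable_pairOf_letter (Or.inr (Or.inl rfl))
  | mul x y _ _ hx hy => exact hx.pairOf_mul hy

theorem Approximable.pairOf_idOn_inter {A B : Set X} {hA : MeasurableSet A}
    {hB : MeasurableSet B} (h1 : Approximable π Φ (pairOf Sig π (idOn R A hA)))
    (h2 : Approximable π Φ (pairOf Sig π (idOn R B hB))) :
    Approximable π Φ (pairOf Sig π (idOn R (A ∩ B) (hA.inter hB))) := by
  rw [← idOn_mul_idOn hA hB]
  exact h1.pairOf_mul h2

/-- The projection `χ_A` can be approximated. -/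
def ApproximableSet (Sig : SoficApprox R) (π : UBRep R V) (Φ : Set (PMorph R)) (A : Set X) :
    Prop :=
  ∃ hA : MeasurableSet A, Approximable π Φ (pairOf Sig π (idOn R A hA))

theorem ApproximableSet.compl {A : Set X} (h : ApproximableSet Sig π Φ A) :
    ApproximableSet Sig π Φ Aᶜ :=
  let ⟨hA, h⟩ := h
  ⟨hA.compl, h.pairOf_idOn_compl⟩

theorem ApproximableSet.inter {A B : Set X} (hA : ApproximableSet Sig π Φ A)
    (hB : ApproximableSet Sig π Φ B) : ApproximableSet Sig π Φ (A ∩ B) :=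
  let ⟨_, hA⟩ := hA
  let ⟨_, hB⟩ := hB
  ⟨_, hA.pairOf_idOn_inter hB⟩

theorem ApproximableSet.union {A B : Set X} (hA : ApproximableSet Sig π Φ A)
    (hB : ApproximableSet Sig π Φ B) : ApproximableSet Sig π Φ (A ∪ B) := by
  rw [Set.union_eq_compl_compl_inter_compl]
  exact (hA.compl.inter hB.compl).compl

theorem approximableSet_univ : ApproximableSet Sig π Φ Set.univ := by
  refine ⟨MeasurableSet.univ, ?_⟩
  rw [idOn_univ]
  exact approximable_pairOf_letter (Or.inr (Or.inl rfl))

theorem approximableSet_empty : ApproximableSet Sig π Φ ∅ := by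
  rw [← Set.compl_univ]
  exact approximableSet_univ.compl

theorem ApproximableSet.of_tendsto [IsFiniteMeasure μ] {A : Set X} (hA : MeasurableSet A)
    {E : ℕ → Set X} (hE : ∀ n, ApproximableSet Sig π Φ (E n)) (hsub : ∀ n, E n ⊆ A)
    (hlim : Tendsto (fun n => μ.real (A \ E n)) atTop (𝓝 0)) :
    ApproximableSet Sig π Φ A := by
  refine ⟨hA, approximable_of_tendsto (fun n => (hE n).1) hsub hlim fun n => ?_⟩
  rw [idOn_mul_idOn, idOn_congr (Set.inter_eq_right.2 (hsub n)) _ (hE n).1]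
  exact (hE n).2

/-- Finite unions are approximable, and they exhaust the countable union in measure. -/
theorem ApproximableSet.iUnion [IsFiniteMeasure μ] {E : ℕ → Set X}
    (hE : ∀ n, ApproximableSet Sig π Φ (E n)) : ApproximableSet Sig π Φ (⋃ n, E n) := by
  have hacc : ∀ n, ApproximableSet Sig π Φ (Set.accumulate E n) := by
    intro n
    induction n with
    | zero => simpa [Set.accumulate] using hE 0
    | succ n ih =>
      rw [Set.accumulate_succ]
      exact ih.union (hE _)
  have hm : MeasurableSet (⋃ n, E n) := MeasurableSet.iUnion fun n => (hE n).1
  refine .of_tendsto hm hacc (fun n => Set.accumulate_subset_iUnion n) ?_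
  refine tendsto_measureReal_diff hm (fun n => (hacc n).1) Set.monotone_accumulate ?_
  rw [Set.iUnion_accumulate, Set.sdiff_self, measure_empty]

/-- A null set is exhausted, in measure, by the constant sequence `∅`; so `B` can be corrected on
the two null differences. -/
theorem ApproximableSet.congr_ae [IsFiniteMeasure μ] {A B : Set X} (hA : MeasurableSet A)
    (hB : ApproximableSet Sig π Φ B) (h : A =ᵐ[μ] B) : ApproximableSet Sig π Φ A := by
  have hnull : ∀ N : Set X, MeasurableSet N → μ N = 0 → ApproximableSet Sig π Φ N := by
    intro N hN h0
    refine .of_tendsto hN (fun _ => approximableSet_empty) (fun _ => Set.empty_subset _) ?_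
    simp [measureReal_def, h0]
  have h1 := hnull _ (hA.diff hB.1) (ae_eq_set.1 h).1
  have h2 := hnull _ (hB.1.diff hA) (ae_eq_set.1 h).2
  have : A = (B ∩ (B \ A)ᶜ) ∪ (A \ B) := by
    ext x
    simp only [Set.mem_union, Set.mem_inter_iff, Set.mem_compl_iff, Set.mem_sdiff]
    tauto
  rw [this]
  exact (hB.inter h2.compl).union h1

/-- The approximable sets form a `σ`-algebra that is stable under null modifications. It contains
the generators because the projection onto `w(P ∩ dom w)` is the word `w χ_P w⁻¹`. -/
theorem approximableSet_of_isGenerating [IsFiniteMeasure μ] (hΦ : IsGenerating Φ) {A : Set X}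
    (hA : MeasurableSet A) : ApproximableSet Sig π Φ A := by
  obtain ⟨Φ₀, P, -, hPm, hgen, rfl⟩ := hΦ
  obtain ⟨A', hA', hAA'⟩ := hgen A hA
  refine ApproximableSet.congr_ae hA ?_ hAA'
  refine MeasurableSpace.generateFrom_induction _ (fun s _ => ApproximableSet Sig π _ s) ?_ ?_ ?_
    ?_ A' hA'
  · rintro _ ⟨w, hw, B, hB, rfl⟩ -
    have hcl : w.prod ∈ Submonoid.closure (letters (Φ₀ ∪
        {φ | ∃ A ∈ P, ∃ hA : MeasurableSet A, φ = idOn R A hA})) :=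
      Submonoid.list_prod_mem _ fun φ hφ =>
        Submonoid.subset_closure (letters_mono Set.subset_union_left (hw φ hφ))
    have hBm := hPm B hB
    have hid : idOn R B hBm ∈ Submonoid.closure (letters (Φ₀ ∪
        {φ | ∃ A ∈ P, ∃ hA : MeasurableSet A, φ = idOn R A hA})) :=
      Submonoid.subset_closure (Or.inl (Or.inr ⟨B, hB, hBm, rfl⟩))
    have himg : w.prod.toPE '' (w.prod.toPE.source ∩ B) =
        w.prod.toPE.target ∩ w.prod.toPE.symm ⁻¹' B := w.prod.toPE.image_source_inter_eq' B
    have hQm : MeasurableSet (w.prod.toPE '' (w.prod.toPE.source ∩ B)) := by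
      rw [himg]
      exact w.prod.measurable_inv B hBm
    refine ⟨hQm, ?_⟩
    have hcongr : (w.prod * idOn R B hBm * w.prod.inv).toPE ≈ (idOn R _ hQm).toPE := by
      have hs : (w.prod * idOn R B hBm * w.prod.inv).toPE.source =
          w.prod.toPE '' (w.prod.toPE.source ∩ B) := by
        rw [himg, mul_toPE, PartialEquiv.trans_source, mul_idOn_source_eq]
        ext x
        constructor
        · exact fun hx => ⟨hx.1, hx.2.1⟩
        · exact fun hx => ⟨hx.1, hx.2, w.prod.toPE.map_target hx.1⟩
      refine ⟨hs, fun x hx => ?_⟩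
      rw [hs, himg] at hx
      exact w.prod.toPE.right_inv hx.1
    rw [← pairOf_congr Sig π hcongr]
    exact approximable_pairOf_of_mem_closure
      (mul_mem (mul_mem hcl hid) (inv_mem_closure_letters hcl))
  · exact approximableSet_empty
  · exact fun _ _ h => h.compl
  · exact fun _ _ h => ApproximableSet.iUnion h

/-- There are countably many words in the graphing, and at almost every point of its domain `φ`
agrees with one of them. On measurable pieces of the agreement sets `φ` is a word times a
projection; finitely many disjoint pieces are added up, and these exhaust the domain in measure. -/
theorem approximable_pairOf [IsFiniteMeasure μ] (hΦ : IsGenerating Φ) (φ : PMorph R) :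
    Approximable π Φ (pairOf Sig π φ) := by
  have hset : ∀ {A : Set X} (hA : MeasurableSet A),
      Approximable π Φ (pairOf Sig π (idOn R A hA)) := fun hA =>
    (approximableSet_of_isGenerating hΦ hA).2
  obtain ⟨Φ₀, P, ⟨hcount, hgraph⟩, -, -, hΦeq⟩ := hΦ
  have hsubm : Submonoid.closure (letters Φ₀) ≤ Submonoid.closure (letters Φ) :=
    Submonoid.closure_mono (letters_mono (hΦeq ▸ Set.subset_union_left))
  obtain ⟨ψ, hψ⟩ := (countable_closure_letters hcount).exists_eq_range ⟨1, one_mem _⟩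
  have hψmem : ∀ n, ψ n ∈ Submonoid.closure (letters Φ₀) := fun n => by
    rw [← SetLike.mem_coe, hψ]
    exact ⟨n, rfl⟩
  set E : ℕ → Set X := fun n =>
    {x | x ∈ φ.toPE.source ∩ (ψ n).toPE.source ∧ φ.toPE x = (ψ n).toPE x} with hE
  have hEm : ∀ n, MeasurableSet (E n) := fun n => measurableSet_eq_on_source φ (ψ n)
  have hEsub : ∀ n, E n ⊆ φ.toPE.source := fun n x hx => hx.1.1
  have hpiece : ∀ n (B : Set X) (hB : MeasurableSet B), B ⊆ E n →
      Approximable π Φ (pairOf Sig π (φ * idOn R B hB)) := by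
    intro n B hB hBE
    have : (φ * idOn R B hB).toPE ≈ (ψ n * idOn R B hB).toPE := by
      refine ⟨?_, fun x hx => ?_⟩
      · rw [mul_idOn_source_eq, mul_idOn_source_eq,
          Set.inter_eq_left.2 fun x hx => (hBE hx).1.1,
          Set.inter_eq_left.2 fun x hx => (hBE hx).1.2]
      · rw [mul_idOn_source_eq] at hx
        exact (hBE hx.1).2
    rw [pairOf_congr Sig π this]
    exact (approximable_pairOf_of_mem_closure (hsubm (hψmem n))).pairOf_mul (hset hB)
  have haccm : ∀ n, MeasurableSet (Set.accumulate E n) := fun n =>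
    MeasurableSet.biUnion (Set.to_countable _) fun k _ => hEm k
  have hacc : ∀ n, Approximable π Φ (pairOf Sig π (φ * idOn R _ (haccm n))) := by
    intro n
    induction n with
    | zero =>
      refine hpiece 0 _ _ ?_
      simp [Set.accumulate]
    | succ n ih =>
      have hd : MeasurableSet (E (n + 1) \ Set.accumulate E n) := (hEm _).diff (haccm n)
      have hun : Set.accumulate E (n + 1) =
          Set.accumulate E n ∪ (E (n + 1) \ Set.accumulate E n) := by
        rw [Set.accumulate_succ, Set.union_sdiff_self]
      rw [idOn_congr hun _ ((haccm n).union hd)]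
      have hdisj : Disjoint (Set.accumulate E n) (E (n + 1) \ Set.accumulate E n) :=
        Set.disjoint_sdiff_right
      refine (ih.add (hpiece (n + 1) _ hd Set.sdiff_subset)).of_rowNegligible ?_ ?_
      · refine ContinuousLinearMap.ext fun v => ?_
        change π.act _ v = π.act _ v + π.act _ v
        rw [← π.act_mul, ← π.act_mul, ← π.act_mul, π.act_union _ _ (haccm n) hd hdisj,
          _root_.add_apply, map_add]
      · intro η hη
        have hη4 : 0 < η / 4 := by positivity
        filter_upwards [rowNegligible_mul Sig φ (idOn R _ (haccm n)) _ hη4,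
          rowNegligible_mul Sig φ (idOn R _ hd) _ hη4,
          rowNegligible_mul Sig φ (idOn R _ ((haccm n).union hd)) _ hη4,
          rowNegligible_idOn_union Sig (haccm n) hd hdisj _ hη4] with i h1 h2 h3 h4
        set a := Sig.σ i (vv φ)
        set b := Sig.σ i (vv (idOn R _ (haccm n)))
        set c := Sig.σ i (vv (idOn R _ hd))
        set e := Sig.σ i (vv (idOn R _ ((haccm n).union hd)))
        set ab := Sig.σ i (vv (φ * idOn R _ (haccm n)))
        set ac := Sig.σ i (vv (φ * idOn R _ hd))
        set ae := Sig.σ i (vv (φ * idOn R _ ((haccm n).union hd)))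
        change ((rowSupp (ae - (ab + ac))).card : ℝ) ≤ _
        -- With `e = b + c` up to few rows, the four errors are three multiplicativity defects and
        -- one additivity defect.
        have hid : ae - (ab + ac) = ((ae - a * e) + a * (e - b - c)) +
            (-(ab - a * b) + -(ac - a * c)) := by
          simp only [mul_sub]
          abel
        have k1 := card_rowSupp_add ((ae - a * e) + a * (e - b - c))
            (-(ab - a * b) + -(ac - a * c))
        have k2 := card_rowSupp_add (ae - a * e) (a * (e - b - c))
        have k3 := card_rowSupp_add (-(ab - a * b)) (-(ac - a * c))
        have k4 : _ ≤ 1 * _ := rowBounded_sigma Sig i φ (e - b - c)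
        rw [rowSupp_neg, rowSupp_neg] at k3
        have k5 : ((rowSupp (ae - (ab + ac))).card : ℝ) ≤
            ((rowSupp (ae - a * e)).card + (rowSupp (e - b - c)).card) +
              ((rowSupp (ab - a * b)).card + (rowSupp (ac - a * c)).card) := by
          rw [hid]
          rw [one_mul] at k4
          exact_mod_cast k1.trans (add_le_add (k2.trans (add_le_add le_rfl k4)) k3)
        linarith
  refine approximable_of_tendsto haccm
    (fun n => Set.iUnion₂_subset fun k _ => hEsub k) ?_ hacc
  refine tendsto_measureReal_diff φ.measurableSet_source haccm Set.monotone_accumulate ?_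
  rw [Set.iUnion_accumulate]
  have hae : ∀ᵐ x ∂μ, x ∈ φ.toPE.source → x ∈ ⋃ n, E n := by
    -- The graphing property is needed at the point `φ x`, because `R` contains `(φ x, x)`; it holds
    -- there for almost every `x` since preimages of null sets under `φ` are null. The path is then
    -- reversed.
    filter_upwards [φ.ae_of_ae hgraph, φ.ae_rel] with x h1 h2 hx
    obtain ⟨χ, hχ, hχs, hχx⟩ := exists_mem_closure_letters_of_eqvGen (h1 hx x (h2 hx)).symm
    rw [← SetLike.mem_coe, hψ] at hχ
    obtain ⟨n, rfl⟩ := hχ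
    exact Set.mem_iUnion.2 ⟨n, ⟨hx, hχs⟩, hχx.symm⟩
  rw [ae_iff] at hae
  convert hae using 2
  ext x
  simp

end Generating

/-! ### Vectors that are small outside few coordinates -/

section CutSmall

variable {p : ℝ≥0∞} [Fact (1 ≤ p)] {n : ℕ}

theorem matApply_sub (M : Matrix (Fin n) (Fin n) ℂ) (f g : ellp p n) :
    matApply p M (f - g) = matApply p M f - matApply p M g := by
  rw [eq_sub_iff_add_eq, ← matApply_add, sub_add_cancel]

/-- `f` has norm less than `κ` off a fraction `κ` of the coordinates. -/
def CutSmall (κ : ℝ) (f : ellp p n) : Prop :=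
  ∃ A : Finset (Fin n), (Aᶜ.card : ℝ) ≤ κ * n ∧ ‖cut A f‖ < κ

theorem CutSmall.mono {κ κ' : ℝ} {f : ellp p n} (h : CutSmall κ f) (hκ : κ ≤ κ') :
    CutSmall κ' f := by
  obtain ⟨A, hA, hf⟩ := h
  exact ⟨A, hA.trans (by gcongr), hf.trans_le hκ⟩

theorem CutSmall.add (hp : p ≠ ∞) {κ κ' : ℝ} {f g : ellp p n} (hf : CutSmall κ f)
    (hg : CutSmall κ' g) : CutSmall (κ + κ') (f + g) := by
  obtain ⟨A, hA, hf⟩ := hf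
  obtain ⟨B, hB, hg⟩ := hg
  refine ⟨A ∩ B, ?_, ?_⟩
  · rw [add_mul]
    exact (card_compl_inter_le A B).trans (add_le_add hA hB)
  · rw [cut_add]
    refine (norm_add_le _ _).trans_lt (add_lt_add ?_ ?_)
    · exact (norm_cut_mono hp Finset.inter_subset_left f).trans_lt hf
    · exact (norm_cut_mono hp Finset.inter_subset_right g).trans_lt hg

/-- Scaling changes the norm but not the exceptional set, hence two separate conditions on `κ'`. -/
theorem CutSmall.smul {κ κ' : ℝ} {f : ellp p n} (hf : CutSmall κ f) (c : ℂ)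
    (h1 : κ ≤ κ') (h2 : ‖c‖ * κ < κ') : CutSmall κ' (c • f) := by
  obtain ⟨A, hA, hf⟩ := hf
  refine ⟨A, hA.trans (by gcongr), ?_⟩
  rw [cut_smul, norm_smul]
  refine lt_of_le_of_lt ?_ h2
  gcongr

theorem CutSmall.neg {κ : ℝ} {f : ellp p n} (hf : CutSmall κ f) : CutSmall κ (-f) := by
  obtain ⟨A, hA, hf⟩ := hf
  refine ⟨A, hA, ?_⟩
  rwa [← neg_one_smul ℂ f, cut_smul, neg_one_smul, norm_neg]

theorem cutSmall_of_norm_lt {κ : ℝ} {f : ellp p n} (hf : ‖f‖ < κ) : CutSmall κ f := by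
  have hκ : 0 ≤ κ := (norm_nonneg f).trans hf.le
  refine ⟨Finset.univ, ?_, (norm_cut_le _ f).trans_lt hf⟩
  simp only [Finset.compl_univ, Finset.card_empty, Nat.cast_zero]
  positivity

/-- Deleting the nonzero rows leaves `0`, so neither the size of the entries nor that of `f`
matters. -/
theorem cutSmall_matApply_of_rowSupp {κ : ℝ} (hκ : 0 < κ) {M : Matrix (Fin n) (Fin n) ℂ}
    (hM : ((rowSupp M).card : ℝ) ≤ κ * n) (f : ellp p n) : CutSmall κ (matApply p M f) := by
  refine ⟨(rowSupp M)ᶜ, by rwa [compl_compl], ?_⟩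
  rw [cut_matApply_eq_zero disjoint_compl_left, norm_zero]
  exact hκ

theorem CutSmall.toMatrix (hp : p ≠ ∞) {κ : ℝ} {f : ellp p n} (hf : CutSmall κ f)
    (e : Fin n ≃. Fin n) :
    CutSmall κ (matApply p (e.toMatrix : Matrix (Fin n) (Fin n) ℂ) f) := by
  obtain ⟨A, hA, hf⟩ := hf
  obtain ⟨D, hD, hDf⟩ := exists_norm_cut_toMatrix_le hp e A
  exact ⟨D, (Nat.cast_le.2 hD).trans hA, (hDf f).trans_lt hf⟩

end CutSmall

/-! ### Evaluating a map defined on a subspace -/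

section EvalOn

variable {V E : Type*} [NormedAddCommGroup V] [NormedSpace ℂ V] [NormedAddCommGroup E]
  [NormedSpace ℂ E] {U : Submodule ℂ V}

open Classical in
/-- The value at `y` of a map defined on `U`, and `0` if `y ∉ U`. -/
noncomputable def evalOn (T : U →L[ℂ] E) (y : V) : E :=
  if h : y ∈ U then T ⟨y, h⟩ else 0

theorem evalOn_of_mem (T : U →L[ℂ] E) {y : V} (h : y ∈ U) : evalOn T y = T ⟨y, h⟩ := dif_pos h

theorem evalOn_add (T : U →L[ℂ] E) {y z : V} (hy : y ∈ U) (hz : z ∈ U) :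
    evalOn T (y + z) = evalOn T y + evalOn T z := by
  rw [evalOn_of_mem T hy, evalOn_of_mem T hz, evalOn_of_mem T (U.add_mem hy hz), ← map_add]
  rfl

theorem evalOn_sub (T : U →L[ℂ] E) {y z : V} (hy : y ∈ U) (hz : z ∈ U) :
    evalOn T (y - z) = evalOn T y - evalOn T z := by
  rw [evalOn_of_mem T hy, evalOn_of_mem T hz, evalOn_of_mem T (U.sub_mem hy hz), ← map_sub]
  rfl

theorem evalOn_neg (T : U →L[ℂ] E) {y : V} (hy : y ∈ U) : evalOn T (-y) = -evalOn T y := by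
  rw [evalOn_of_mem T hy, evalOn_of_mem T (U.neg_mem hy), ← map_neg]
  rfl

theorem evalOn_smul (T : U →L[ℂ] E) (c : ℂ) {y : V} (hy : y ∈ U) :
    evalOn T (c • y) = c • evalOn T y := by
  rw [evalOn_of_mem T hy, evalOn_of_mem T (U.smul_mem c hy), ← map_smul]
  rfl

theorem evalOn_zero (T : U →L[ℂ] E) : evalOn T 0 = 0 := by
  rw [evalOn_of_mem T U.zero_mem]
  exact map_zero T

theorem norm_evalOn_le {T : U →L[ℂ] E} (hT : ‖T‖ ≤ 1) {y : V} (hy : y ∈ U) :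
    ‖evalOn T y‖ ≤ ‖y‖ := by
  rw [evalOn_of_mem T hy]
  exact (T.le_opNorm _).trans (mul_le_of_le_one_left (norm_nonneg _) hT)

end EvalOn

/-! ### Spans of words and almost equivariance -/

section Words

variable {X : Type*} [MeasurableSpace X] {μ : Measure X} [StandardBorelSpace X] {R : MPRel X μ}
  {V : Type*} [NormedAddCommGroup V] [NormedSpace ℂ V]

/-- The filter along which the parameters `(F, m, δ)` tend to their limit. -/
abbrev paramFilter (Φ : Set (PMorph R)) : Filter (Finset Φ × ℕ × ℝ) :=
  atTop ×ˢ (atTop ×ˢ 𝓝[>] (0 : ℝ))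

/-- The finite set of partial morphisms of a parameter `(F, m, δ)`. -/
abbrev paramSet {Φ : Set (PMorph R)} (t : Finset Φ × ℕ × ℝ) : Set (PMorph R) :=
  Subtype.val '' (t.1 : Set Φ)

variable {Φ : Set (PMorph R)}

theorem eventually_lt_param (k : ℕ) : ∀ᶠ t in paramFilter Φ, k < t.2.1 :=
  (tendsto_fst.comp tendsto_snd).eventually (eventually_gt_atTop k)

theorem eventually_param_lt {κ : ℝ} (hκ : 0 < κ) : ∀ᶠ t in paramFilter Φ, t.2.2 < κ :=
  (tendsto_snd.comp tendsto_snd).eventually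
    (eventually_nhdsWithin_of_eventually_nhds (gt_mem_nhds hκ))

theorem eventually_param_pos : ∀ᶠ t in paramFilter Φ, 0 < t.2.2 :=
  (tendsto_snd.comp tendsto_snd).eventually self_mem_nhdsWithin

theorem eventually_mem_letters {φ : PMorph R} (h : φ ∈ letters Φ) :
    ∀ᶠ t in paramFilter Φ, φ ∈ letters (paramSet t) := by
  have key : ∀ ψ ∈ Φ, ∀ᶠ t in paramFilter Φ, ψ ∈ paramSet t := by
    intro ψ hψ
    filter_upwards [tendsto_fst.eventually (eventually_ge_atTop ({⟨ψ, hψ⟩} : Finset Φ))] with t ht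
    exact ⟨⟨ψ, hψ⟩, ht (Finset.mem_singleton_self _), rfl⟩
  rcases h with h | h | h
  · filter_upwards [key _ h] with t ht using Or.inl ht
  · exact Eventually.of_forall fun t => Or.inr (Or.inl h)
  · filter_upwards [key _ h] with t ht using Or.inr (Or.inr ht)

theorem eventually_mem_words {w : List (PMorph R)} (h : ∀ φ ∈ w, φ ∈ letters Φ) :
    ∀ᶠ t in paramFilter Φ, w ∈ words (paramSet t) t.2.1 := by
  have h1 : ∀ᶠ t in paramFilter Φ, ∀ φ ∈ w, φ ∈ letters (paramSet t) := by
    have := (w.finite_toSet.eventually_all (l := paramFilter Φ)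
      (p := fun φ t => φ ∈ letters (paramSet t))).2 fun φ hφ => eventually_mem_letters (h φ hφ)
    exact this
  filter_upwards [h1, eventually_lt_param w.length] with t h1 h2
  exact ⟨h2.le, h1⟩

/-- The span of all `w v_j`, with `w` a word in `Φ`. -/
def wordSpanAll (π : UBRep R V) (S : ℕ → V) (Φ : Set (PMorph R)) : Submodule ℂ V :=
  Submodule.span ℂ {u | ∃ w : List (PMorph R), (∀ φ ∈ w, φ ∈ letters Φ) ∧
    ∃ j, u = π.act w.prod (S j)}

variable {π : UBRep R V} {S : ℕ → V}

theorem act_mem_wordSpan {F : Set (PMorph R)} {m : ℕ} {w : List (PMorph R)} (hw : w ∈ words F m)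
    {j : ℕ} (hj : j < m) : π.act w.prod (S j) ∈ wordSpan π S F m :=
  Submodule.subset_span ⟨w, hw, j, hj, rfl⟩

theorem gen_mem_wordSpan {F : Set (PMorph R)} {m : ℕ} {j : ℕ} (hj : j < m) :
    S j ∈ wordSpan π S F m :=
  (genVec π S F m j hj).2

/-- A vector of the full span involves only finitely many letters, word lengths and indices. -/
theorem eventually_mem_wordSpan {y : V} (hy : y ∈ wordSpanAll π S Φ) :
    ∀ᶠ t in paramFilter Φ, y ∈ wordSpan π S (paramSet t) t.2.1 := by
  induction hy using Submodule.span_induction with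
  | mem x hx =>
    obtain ⟨w, hw, j, rfl⟩ := hx
    filter_upwards [eventually_mem_words hw, eventually_lt_param j] with t h1 h2
    exact act_mem_wordSpan h1 h2
  | zero => exact Eventually.of_forall fun t => Submodule.zero_mem _
  | add x y _ _ hx hy =>
    filter_upwards [hx, hy] with t h1 h2 using Submodule.add_mem _ h1 h2
  | smul c x _ hx =>
    filter_upwards [hx] with t h1 using Submodule.smul_mem _ c h1

variable {Sig : SoficApprox R}

theorem act_one_eq : π.act 1 = 1 := ContinuousLinearMap.ext π.act_one

theorem fst_wordPair (w : List (PMorph R)) :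
    (w.map (pairOf Sig π)).prod.1 = π.act w.prod := by
  induction w with
  | nil => exact act_one_eq.symm
  | cons φ w ih =>
    rw [List.map_cons, List.prod_cons, List.prod_cons, Prod.fst_mul, ih]
    exact ContinuousLinearMap.ext fun v => π.act_mul _ _ v

theorem snd_wordPair (w : List (PMorph R)) (i : ℕ) :
    (w.map (pairOf Sig π)).prod.2 i = (w.map fun φ => Sig.σ i (vv φ)).prod := by
  induction w with
  | nil => rfl
  | cons φ w ih =>
    rw [List.map_cons, List.prod_cons, List.map_cons, List.prod_cons, Prod.snd_mul, ← ih]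
    rfl

theorem approximable_wordPair [IsFiniteMeasure μ] (hΦ : IsGenerating Φ) (w : List (PMorph R)) :
    Approximable π Φ (w.map (pairOf Sig π)).prod := by
  induction w with
  | nil => exact approximable_of_mem (one_mem _)
  | cons φ w ih =>
    rw [List.map_cons, List.prod_cons]
    exact (approximable_pairOf hΦ φ).mul ih

theorem exists_wordPair_of_mem_closure {z : OpPair Sig V}
    (hz : z ∈ Submonoid.closure (pairOf Sig π '' letters Φ)) :
    ∃ w : List (PMorph R), (∀ φ ∈ w, φ ∈ letters Φ) ∧ z = (w.map (pairOf Sig π)).prod := by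
  induction hz using Submonoid.closure_induction with
  | mem x hx =>
    obtain ⟨φ, hφ, rfl⟩ := hx
    exact ⟨[φ], by simpa using hφ, by simp⟩
  | one => exact ⟨[], by simp, by simp⟩
  | mul x y _ _ hx hy =>
    obtain ⟨w, hw, rfl⟩ := hx
    obtain ⟨w', hw', rfl⟩ := hy
    refine ⟨w ++ w', fun φ hφ => ?_, by simp⟩
    exact (List.mem_append.1 hφ).elim (hw φ) (hw' φ)

/-- Additively, the ring is generated by the products of its generators. Properties of a pair at a
fixed vector can thus be proved without a multiplicative step. -/
theorem wordRing_induction {P : OpPair Sig V → Prop}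
    (hw : ∀ w : List (PMorph R), (∀ φ ∈ w, φ ∈ letters Φ) → P (w.map (pairOf Sig π)).prod)
    (h0 : P 0) (hadd : ∀ a b, P a → P b → P (a + b)) (hneg : ∀ a, P a → P (-a))
    {z : OpPair Sig V} (hz : z ∈ wordRing Sig π Φ) : P z := by
  rw [wordRing, Subring.mem_closure_iff] at hz
  induction hz using AddSubgroup.closure_induction with
  | mem x hx =>
    obtain ⟨w, h1, rfl⟩ := exists_wordPair_of_mem_closure hx
    exact hw w h1
  | zero => exact h0
  | add a b _ _ ha hb => exact hadd a b ha hb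
  | neg a _ ha => exact hneg a ha

theorem wordRing_apply_gen_mem {z : OpPair Sig V} (hz : z ∈ wordRing Sig π Φ) (j : ℕ) :
    z.1 (S j) ∈ wordSpanAll π S Φ := by
  refine wordRing_induction (P := fun z => z.1 (S j) ∈ wordSpanAll π S Φ) ?_ ?_ ?_ ?_ hz
  · intro w hw
    rw [fst_wordPair]
    exact Submodule.subset_span ⟨w, hw, j, rfl⟩
  · exact Submodule.zero_mem _
  · exact fun a b ha hb => Submodule.add_mem _ ha hb
  · exact fun a ha => Submodule.neg_mem _ ha

/-- Each `φ v_j` is a limit of integral combinations of words in `Φ` applied to `v_j`. The sofic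
approximation enters only through the pairs in which this approximation is phrased. -/
theorem dense_wordSpanAll [IsFiniteMeasure μ] (Sig : SoficApprox R) (hΦ : IsGenerating Φ)
    (hS : DynGenerating π S) : Dense (wordSpanAll π S Φ : Set V) := by
  rw [← Submodule.dense_iff_topologicalClosure_eq_top.symm.eq, eq_top_iff, ← hS.2]
  refine Submodule.topologicalClosure_minimal _ (Submodule.span_le.2 ?_)
    (Submodule.isClosed_topologicalClosure _)
  rintro _ ⟨φ, j, rfl⟩
  rw [SetLike.mem_coe, ← SetLike.mem_coe, Submodule.topologicalClosure_coe, Metric.mem_closure_iff]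
  intro η hη
  obtain ⟨z, hz, hnear⟩ := approximable_pairOf (Sig := Sig) (π := π) hΦ φ {S j}
    (Set.finite_singleton _) η hη
  refine ⟨z.1 (S j), wordRing_apply_gen_mem hz j, ?_⟩
  rw [dist_eq_norm]
  exact hnear.1 _ rfl

variable {p : ℝ≥0∞} [Fact (1 ≤ p)]

theorem cutSmall_of_mem_almostHom {F : Set (PMorph R)} {m i : ℕ}
    {δ : ℝ}
    {T : wordSpan π S F m →L[ℂ] ellp p (Sig.d i)} (hT : T ∈ almostHom p Sig π S F m δ i)
    {w : List (PMorph R)} (hw : w ∈ words F m) {j : ℕ} (hj : j < m) :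
    CutSmall δ (evalOn T (π.act w.prod (S j)) -
      matApply p (w.map fun φ => Sig.σ i (vv φ)).prod (evalOn T (S j))) := by
  obtain ⟨-, A, hA, h⟩ := hT
  refine ⟨A, (card_le_iff_compl _ _).1 hA, ?_⟩
  rw [evalOn_of_mem T (act_mem_wordSpan hw hj), evalOn_of_mem T (gen_mem_wordSpan hj)]
  exact h w hw j hj

theorem CutSmall.word (hp : p ≠ ∞) {i : ℕ} {κ : ℝ}
    {f : ellp p (Sig.d i)} (hf : CutSmall κ f) (w : List (PMorph R)) :
    CutSmall κ (matApply p (w.map fun φ => Sig.σ i (vv φ)).prod f) := by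
  obtain ⟨e, he⟩ := exists_pequiv_list_prod (w.map fun φ => Sig.σ i (vv φ)) (by
    intro M hM
    obtain ⟨φ, -, rfl⟩ := List.mem_map.1 hM
    exact Sig.map_pmorph i φ)
  rw [he]
  exact hf.toMatrix hp e

/-- Almost equivariant maps asymptotically intertwine, at `y`, the two entries of the pair `z`. -/
def Intertwined (S : ℕ → V) (Φ : Set (PMorph R)) (p : ℝ≥0∞) [Fact (1 ≤ p)] (π : UBRep R V) (z : OpPair Sig V) (y : V) : Prop :=
  ∀ κ : ℝ, 0 < κ → ∀ᶠ t in paramFilter Φ, y ∈ wordSpan π S (paramSet t) t.2.1 ∧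
    z.1 y ∈ wordSpan π S (paramSet t) t.2.1 ∧
    ∀ i, ∀ T ∈ almostHom p Sig π S (paramSet t) t.2.1 t.2.2 i,
      CutSmall κ (evalOn T (z.1 y) - matApply p (z.2 i) (evalOn T y))

/-- Use almost equivariance at the words `wu` and `u`. The error at `u` survives multiplication by
the matrices of `w`, whose product is a partial permutation matrix. -/
theorem intertwined_word (hp : p ≠ ∞) {w u : List (PMorph R)} (hw : ∀ φ ∈ w, φ ∈ letters Φ)
    (hu : ∀ φ ∈ u, φ ∈ letters Φ) (j : ℕ) :
    Intertwined S Φ p π (w.map (pairOf Sig π)).prod (π.act u.prod (S j)) := by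
  intro κ hκ
  have hwu : ∀ φ ∈ w ++ u, φ ∈ letters Φ := fun φ hφ =>
    (List.mem_append.1 hφ).elim (hw φ) (hu φ)
  filter_upwards [eventually_mem_words hu, eventually_mem_words hwu, eventually_lt_param j,
    eventually_param_lt (half_pos hκ)] with t h1 h2 h3 h4
  have hact : (w.map (pairOf Sig π)).prod.1 (π.act u.prod (S j)) =
      π.act (w ++ u).prod (S j) := by
    rw [fst_wordPair, π.act_mul, List.prod_append]
  rw [hact]
  refine ⟨act_mem_wordSpan h1 h3, act_mem_wordSpan h2 h3, fun i T hT => ?_⟩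
  rw [snd_wordPair]
  have k1 := (cutSmall_of_mem_almostHom hT h2 h3).mono h4.le
  have k2 := (((cutSmall_of_mem_almostHom hT h1 h3).mono h4.le).neg).word hp w
  have k3 := k1.add hp k2
  rw [add_halves] at k3
  convert k3 using 1
  rw [List.map_append, List.prod_append (l₁ := w.map fun φ => Sig.σ i (vv φ)), mul_matApply,
    neg_sub, matApply_sub]
  abel

theorem Intertwined.add_left (hp : p ≠ ∞) {z z' : OpPair Sig V} {y : V}
    (h : Intertwined S Φ p π z y) (h' : Intertwined S Φ p π z' y) :
    Intertwined S Φ p π (z + z') y := by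
  intro κ hκ
  filter_upwards [h _ (half_pos hκ), h' _ (half_pos hκ)] with t h1 h2
  refine ⟨h1.1, Submodule.add_mem _ h1.2.1 h2.2.1, fun i T hT => ?_⟩
  have := (h1.2.2 i T hT).add hp (h2.2.2 i T hT)
  rw [add_halves] at this
  convert this using 1
  change evalOn T (z.1 y + z'.1 y) - matApply p (z.2 i + z'.2 i) _ = _
  rw [evalOn_add T h1.2.1 h2.2.1, add_matApply]
  abel

theorem Intertwined.neg_left {z : OpPair Sig V} {y : V}
    (h : Intertwined S Φ p π z y) : Intertwined S Φ p π (-z) y := by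
  intro κ hκ
  filter_upwards [h _ hκ] with t h1
  refine ⟨h1.1, Submodule.neg_mem _ h1.2.1, fun i T hT => ?_⟩
  convert (h1.2.2 i T hT).neg using 1
  change evalOn T (-(z.1 y)) - matApply p (-(z.2 i)) _ = _
  rw [evalOn_neg T h1.2.1, neg_matApply]
  abel

theorem intertwined_zero_left {y : V} (hy : y ∈ wordSpanAll π S Φ) :
    Intertwined S Φ p π (0 : OpPair Sig V) y := by
  intro κ hκ
  filter_upwards [eventually_mem_wordSpan hy] with t ht
  refine ⟨ht, Submodule.zero_mem _, fun i T _ => cutSmall_of_norm_lt ?_⟩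
  change ‖evalOn T 0 - matApply p 0 _‖ < κ
  rw [evalOn_zero, zero_matApply, sub_zero, norm_zero]
  exact hκ

theorem intertwined_zero_right (z : OpPair Sig V) : Intertwined S Φ p π z 0 := by
  intro κ hκ
  refine Eventually.of_forall fun t => ⟨Submodule.zero_mem _, ?_, fun i T _ =>
    cutSmall_of_norm_lt ?_⟩
  · rw [map_zero]
    exact Submodule.zero_mem _
  · rw [map_zero, evalOn_zero, matApply_zero, sub_zero, norm_zero]
    exact hκ

theorem Intertwined.add_right (hp : p ≠ ∞) {z : OpPair Sig V} {y y' : V}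
    (h : Intertwined S Φ p π z y) (h' : Intertwined S Φ p π z y') :
    Intertwined S Φ p π z (y + y') := by
  intro κ hκ
  filter_upwards [h _ (half_pos hκ), h' _ (half_pos hκ)] with t h1 h2
  rw [map_add]
  refine ⟨Submodule.add_mem _ h1.1 h2.1, Submodule.add_mem _ h1.2.1 h2.2.1, fun i T hT => ?_⟩
  have := (h1.2.2 i T hT).add hp (h2.2.2 i T hT)
  rw [add_halves] at this
  convert this using 1
  rw [evalOn_add T h1.2.1 h2.2.1, evalOn_add T h1.1 h2.1, matApply_add]
  abel

theorem Intertwined.smul_right {z : OpPair Sig V} {y : V}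
    (h : Intertwined S Φ p π z y) (c : ℂ) : Intertwined S Φ p π z (c • y) := by
  intro κ hκ
  have hc : 0 < ‖c‖ + 1 := by positivity
  filter_upwards [h _ (div_pos hκ hc)] with t h1
  rw [map_smul]
  refine ⟨Submodule.smul_mem _ c h1.1, Submodule.smul_mem _ c h1.2.1, fun i T hT => ?_⟩
  have h2 : κ / (‖c‖ + 1) ≤ κ := div_le_self hκ.le (by linarith [norm_nonneg c])
  have h3 : ‖c‖ * (κ / (‖c‖ + 1)) < κ := by
    rw [mul_div_assoc', div_lt_iff₀ hc]
    linarith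
  convert (h1.2.2 i T hT).smul c h2 h3 using 1
  rw [evalOn_smul T c h1.2.1, evalOn_smul T c h1.1, matApply_smul, smul_sub]

theorem intertwined (hp : p ≠ ∞) {z : OpPair Sig V} (hz : z ∈ wordRing Sig π Φ) {y : V}
    (hy : y ∈ wordSpanAll π S Φ) : Intertwined S Φ p π z y := by
  refine wordRing_induction (P := fun z => Intertwined S Φ p π z y) (fun w hw => ?_)
    (intertwined_zero_left hy) (fun a b ha hb => ha.add_left hp hb) (fun a ha => ha.neg_left) hz
  induction hy using Submodule.span_induction with
  | mem x hx =>
    obtain ⟨u, hu, j, rfl⟩ := hx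
    exact intertwined_word hp hw hu j
  | zero => exact intertwined_zero_right _
  | add x y _ _ hx hy => exact hx.add_right hp hy
  | smul c x _ hx => exact hx.smul_right c

end Words

/-! ### Product norms -/

section ProductNorms

/-- By monotonicity `|f k| ρ(e_k) ≤ ρ(f)`, where `e_k` is the `k`-th unit sequence and `ρ(e_k) > 0`.
-/
theorem ProductNorm.exists_lt_of_apply_lt (ρ : ProductNorm) (K : ℕ) {κ : ℝ} (hκ : 0 < κ) :
    ∃ ε : ℝ, 0 < ε ∧ ∀ f : ellInfty ℂ, ρ.ρ f < ε → ∀ k < K, ‖f k‖ < κ := by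
  induction K with
  | zero => exact ⟨1, one_pos, by simp⟩
  | succ K ih =>
    obtain ⟨ε, hε, h⟩ := ih
    set e : ellInfty ℂ := lp.single ∞ K (1 : ℂ) with he
    have hpos : 0 < ρ.ρ e := by
      refine lt_of_le_of_ne (apply_nonneg _ _) fun h0 => ?_
      have h1 := ρ.eq_zero e h0.symm
      have h2 : (e : ℕ → ℂ) K = 1 := by simp [he]
      rw [h1] at h2
      simp at h2
    refine ⟨min ε (κ * ρ.ρ e), lt_min hε (mul_pos hκ hpos), fun f hf k hk => ?_⟩
    rcases Nat.lt_succ_iff_lt_or_eq.1 hk with hk | rfl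
    · exact h f (hf.trans_le (min_le_left _ _)) k hk
    · have h1 : ρ.ρ (f k • e) ≤ ρ.ρ f := by
        refine ρ.mono _ _ fun j => ?_
        by_cases hj : j = k
        · subst hj
          simp [he]
        · simp [he, hj]
      rw [map_smul_eq_mul] at h1
      exact lt_of_mul_lt_mul_right (h1.trans_lt (hf.trans_le (min_le_right _ _))) hpos.le

/-- The characteristic function of `[J, ∞)` as a bounded sequence. -/
noncomputable def tailSeq (J : ℕ) : ellInfty ℂ :=
  ⟨fun j => if J ≤ j then 1 else 0, by
    apply memℓp_infty
    refine ⟨1, ?_⟩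
    rintro _ ⟨j, rfl⟩
    dsimp only
    split_ifs <;> simp⟩

theorem tailSeq_apply (J j : ℕ) : tailSeq J j = if J ≤ j then 1 else 0 := by
  simp only [tailSeq]

theorem norm_tailSeq_le (J : ℕ) : ‖tailSeq J‖ ≤ 1 := by
  refine lp.norm_le_of_forall_le zero_le_one fun j => ?_
  rw [tailSeq_apply]
  split_ifs <;> simp

theorem ProductNorm.tendsto_tailSeq (ρ : ProductNorm) :
    Tendsto (fun J => ρ.ρ (tailSeq J)) atTop (𝓝 0) := by
  have := (ρ.tendsto_iff 0 tailSeq (by simp) norm_tailSeq_le).2 fun j => by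
    refine tendsto_const_nhds.congr' ?_
    filter_upwards [eventually_gt_atTop j] with J hJ
    rw [tailSeq_apply, if_neg (not_le.2 hJ)]
    rfl
  simpa using this

/-- Such an `f` is dominated by `κ · 1 + M · χ_{[J, ∞)}`. The tails tend to `0` pointwise, hence in
`ρ`, so `J` is chosen first and then `κ`. -/
theorem ProductNorm.exists_apply_lt_of_le (ρ : ProductNorm) {M : ℝ} (hM : 0 ≤ M) {ε : ℝ}
    (hε : 0 < ε) : ∃ J : ℕ, ∃ κ : ℝ, 0 < κ ∧ ∀ f : ellInfty ℂ, (∀ j < J, ‖f j‖ ≤ κ) →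
      (∀ j, J ≤ j → ‖f j‖ ≤ M) → ρ.ρ f < ε := by
  have h1 : 0 < ε / 2 / (M + 1) := by positivity
  obtain ⟨J, hJ⟩ := (ρ.tendsto_tailSeq.eventually (gt_mem_nhds h1)).exists
  have hr : 0 ≤ ρ.ρ (tailSeq 0) := apply_nonneg _ _
  set κ := ε / 2 / (ρ.ρ (tailSeq 0) + 1) with hκ
  have hκ0 : 0 < κ := by positivity
  refine ⟨J, κ, hκ0, fun f hf hfM => ?_⟩
  have h2 : ρ.ρ f ≤ ρ.ρ ((κ : ℂ) • tailSeq 0 + (M : ℂ) • tailSeq J) := by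
    refine ρ.mono _ _ fun j => ?_
    rw [lp.coeFn_add, lp.coeFn_smul, lp.coeFn_smul, Pi.add_apply, Pi.smul_apply, Pi.smul_apply,
      tailSeq_apply, tailSeq_apply, if_pos (Nat.zero_le j), smul_eq_mul, smul_eq_mul, mul_one]
    by_cases hj : J ≤ j
    · rw [if_pos hj, mul_one, ← Complex.ofReal_add, Complex.norm_real,
        Real.norm_of_nonneg (by positivity)]
      linarith [hfM j hj]
    · rw [if_neg hj, mul_zero, add_zero, Complex.norm_real, Real.norm_of_nonneg hκ0.le]
      exact hf j (not_le.1 hj)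
  have h3 : ρ.ρ ((κ : ℂ) • tailSeq 0 + (M : ℂ) • tailSeq J) ≤
      κ * ρ.ρ (tailSeq 0) + M * ρ.ρ (tailSeq J) := by
    refine (map_add_le_add _ _ _).trans ?_
    rw [map_smul_eq_mul, map_smul_eq_mul, Complex.norm_real, Complex.norm_real,
      Real.norm_of_nonneg hκ0.le, Real.norm_of_nonneg hM]
  have h4 : κ * ρ.ρ (tailSeq 0) ≤ ε / 2 := by
    rw [hκ, div_mul_eq_mul_div, div_le_iff₀ (by positivity)]
    gcongr
    linarith
  have h5 : M * ρ.ρ (tailSeq J) < ε / 2 := by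
    have := (lt_div_iff₀ (by positivity)).1 hJ
    have := apply_nonneg ρ.ρ (tailSeq J)
    linarith
  linarith

end ProductNorms

/-! ### Approximation of maps on finite-dimensional spaces -/

/-- Move the images of a basis into `D`; the coordinate functionals bound the resulting error. -/
theorem exists_continuousLinearMap_near {E V : Type*} [NormedAddCommGroup E] [NormedSpace ℂ E]
    [FiniteDimensional ℂ E] [NormedAddCommGroup V] [NormedSpace ℂ V] (f : E →L[ℂ] V)
    {D : Submodule ℂ V} (hD : Dense (D : Set V)) {η : ℝ} (hη : 0 < η) :
    ∃ θ : E →L[ℂ] V, (∀ x, θ x ∈ D) ∧ ∀ x, ‖θ x - f x‖ ≤ η * ‖x‖ := by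
  classical
  set b := Module.finBasis ℂ E
  set co : Fin (Module.finrank ℂ E) → (E →L[ℂ] ℂ) := fun k =>
    LinearMap.toContinuousLinearMap (b.coord k) with hco
  set K : ℝ := ∑ k, ‖co k‖ with hK
  have hK0 : 0 ≤ K := by positivity
  have hne : 0 < η / (K + 1) := by positivity
  have hex : ∀ k, ∃ g ∈ D, ‖g - f (b k)‖ < η / (K + 1) := fun k => by
    obtain ⟨g, hg, hd⟩ := Metric.mem_closure_iff.1 (hD (f (b k))) _ hne
    exact ⟨g, hg, by rwa [dist_comm, dist_eq_norm] at hd⟩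
  choose g hgD hg using hex
  refine ⟨∑ k, (co k).smulRight (g k), fun x => ?_, fun x => ?_⟩
  · rw [sum_apply]
    exact D.sum_mem fun k _ => D.smul_mem _ (hgD k)
  · have hx : f x = ∑ k, co k x • f (b k) := by
      conv_lhs => rw [← b.sum_repr x]
      rw [map_sum]
      simp [hco]
    rw [sum_apply, hx, ← Finset.sum_sub_distrib]
    calc ‖∑ k, ((co k).smulRight (g k) x - co k x • f (b k))‖
        ≤ ∑ k, ‖co k‖ * ‖x‖ * (η / (K + 1)) := by
          refine norm_sum_le_of_le _ fun k _ => ?_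
          rw [ContinuousLinearMap.smulRight_apply, ← smul_sub, norm_smul]
          gcongr
          · exact (co k).le_opNorm x
          · exact (hg k).le
      _ = K * (η / (K + 1)) * ‖x‖ := by
          rw [← Finset.sum_mul, ← Finset.sum_mul, ← hK]
          ring
      _ ≤ η * ‖x‖ := by
          gcongr
          rw [mul_div_assoc', div_le_iff₀ (by positivity)]
          nlinarith

theorem card_compl_biUnion_le {n : ℕ} {ι : Type*} (I : Finset ι) (A : ι → Finset (Fin n)) {β : ℝ}
    (h : ∀ k ∈ I, ((A k)ᶜ.card : ℝ) ≤ β * n) :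
    ((I.biUnion fun k => (A k)ᶜ).card : ℝ) ≤ I.card * β * n := by
  calc ((I.biUnion fun k => (A k)ᶜ).card : ℝ) ≤ ∑ k ∈ I, ((A k)ᶜ.card : ℝ) := by
        exact_mod_cast Finset.card_biUnion_le
    _ ≤ ∑ k ∈ I, β * n := Finset.sum_le_sum h
    _ = I.card * β * n := by rw [Finset.sum_const, nsmul_eq_mul, mul_assoc]

theorem compl_biUnion_compl_subset {n : ℕ} {ι : Type*} {I : Finset ι} {A : ι → Finset (Fin n)}
    {k : ι} (hk : k ∈ I) : (I.biUnion fun k => (A k)ᶜ)ᶜ ⊆ A k := by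
  intro r hr
  by_contra h
  exact Finset.mem_compl.1 hr (Finset.mem_biUnion.2 ⟨k, hk, Finset.mem_compl.2 h⟩)

/-! ### Comparing dimensions of almost contained sets -/

/-- If `G` almost contains `K'`, then `L(G)` almost contains `K`, and its dimension is no larger. -/
theorem epsDim_le_epsDim {p : ℝ≥0∞} [Fact (1 ≤ p)] {n : ℕ} {ρ ρ' : ProductNorm} {ε ε' : ℝ}
    {K K' : Set (ellInfty (ellp p n))}
    (L : ellInfty (ellp p n) →ₗ[ℂ] ellInfty (ellp p n))
    (h : ∀ f ∈ K, ∃ f' ∈ K', ∀ g, ∀ C : Finset (Fin n), (1 - ε') * n ≤ C.card →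
      ρ'.ρ (cutNormSeq C (f' - g)) < ε' →
      ∃ D : Finset (Fin n), (1 - ε) * n ≤ D.card ∧ ρ.ρ (cutNormSeq D (f - L g)) < ε) :
    epsDim ρ ε K ≤ epsDim ρ' ε' K' := by
  refine le_iInf fun G => le_iInf fun hG => le_iInf fun hc => ?_
  refine (iInf_le_of_le (G.map L) (iInf_le_of_le inferInstance
    (iInf_le_of_le ?_ (Nat.cast_le.2 (Submodule.finrank_map_le L G)))))
  intro f hf
  obtain ⟨f', hf', hf2⟩ := h f hf
  obtain ⟨g, hg, C, hC, hlt⟩ := hc f' hf'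
  obtain ⟨D, hD, hlt'⟩ := hf2 g C hC hlt
  exact ⟨L g, ⟨g, hg, rfl⟩, D, hD, hlt'⟩

/-- The bounded sequence with finitely many nonzero entries given by linear maps. -/
noncomputable def seqMap {p : ℝ≥0∞} [Fact (1 ≤ p)] {n : ℕ} (J : ℕ)
    (L : ℕ → ellInfty (ellp p n) →ₗ[ℂ] ellp p n) :
    ellInfty (ellp p n) →ₗ[ℂ] ellInfty (ellp p n) where
  toFun f := ⟨fun j => if j < J then L j f else 0, by
    refine Memℓp.of_exponent_ge (memℓp_zero ?_) (zero_le (a := ∞))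
    refine (Set.finite_Iio J).subset ?_
    intro j hj
    by_contra h
    exact hj (if_neg h)⟩
  map_add' f g := by
    ext1
    funext j
    change (if j < J then L j (f + g) else 0) =
      (if j < J then L j f else 0) + (if j < J then L j g else 0)
    split_ifs <;> simp
  map_smul' c f := by
    ext1
    funext j
    change (if j < J then L j (c • f) else 0) = c • (if j < J then L j f else 0)
    split_ifs <;> simp

theorem seqMap_apply {p : ℝ≥0∞} [Fact (1 ≤ p)] {n : ℕ} (J : ℕ)
    (L : ℕ → ellInfty (ellp p n) →ₗ[ℂ] ellp p n) (f : ellInfty (ellp p n)) (j : ℕ) :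
    seqMap J L f j = if j < J then L j f else 0 := rfl

/-! ### Recovering values from the generators, and pulling almost equivariant maps back to `W` -/

section Comparison

variable {X : Type*} [MeasurableSpace X] {μ : Measure X} [StandardBorelSpace X] {R : MPRel X μ}
  {V : Type*} [NormedAddCommGroup V] [NormedSpace ℂ V]
  {W : Type*} [NormedAddCommGroup W] [NormedSpace ℂ W]
  {Sig : SoficApprox R} {p : ℝ≥0∞} [Fact (1 ≤ p)]

theorem finite_letters {F : Set (PMorph R)} (hF : F.Finite) : (letters F).Finite := by
  have hinj : Function.Injective (PMorph.inv : PMorph R → PMorph R) := fun φ ψ h => by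
    have := congrArg PMorph.inv h
    rwa [LpDim.inv_inv, LpDim.inv_inv] at this
  have h1 : letters F = F ∪ ({1} ∪ PMorph.inv ⁻¹' F) := by
    ext φ
    simp only [letters, Set.mem_ofPred_eq, Set.mem_union, Set.mem_singleton_iff, Set.mem_preimage]
  rw [h1]
  exact hF.union ((Set.finite_singleton _).union (hF.preimage hinj.injOn))

theorem finite_words {F : Set (PMorph R)} (hF : F.Finite) (m : ℕ) : (words F m).Finite := by
  have : Finite (letters F) := (finite_letters hF).to_subtype
  refine ((List.finite_length_le (letters F) m).image (List.map Subtype.val)).subset ?_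
  rintro w ⟨hw, hl⟩
  refine ⟨w.pmap Subtype.mk hl, by simpa using hw, ?_⟩
  rw [List.map_pmap]
  simp

theorem finiteDimensional_wordSpan (π : UBRep R V) (S : ℕ → V) {F : Set (PMorph R)}
    (hF : F.Finite) (m : ℕ) : FiniteDimensional ℂ (wordSpan π S F m) := by
  refine FiniteDimensional.span_of_finite ℂ
    ((((finite_words hF m).prod (Set.finite_lt_nat m)).image
      fun a : List (PMorph R) × ℕ => π.act a.1.prod (S a.2)).subset ?_)
  rintro _ ⟨w, hw, j, hj, rfl⟩
  exact ⟨(w, j), ⟨hw, hj⟩, rfl⟩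

theorem alphaS_apply {π : UBRep R V} {S : ℕ → V} {F : Set (PMorph R)} {m n : ℕ}
    (T : wordSpan π S F m →L[ℂ] ellp p n) {j : ℕ} (hj : j < m) :
    alphaS π S F m T j = evalOn T (S j) := by
  rw [evalOn_of_mem T (gen_mem_wordSpan hj)]
  exact dif_pos hj

theorem norm_alphaS_apply_le {π : UBRep R V} {S : ℕ → V} {F : Set (PMorph R)} {m n : ℕ}
    {T : wordSpan π S F m →L[ℂ] ellp p n} (hT : ‖T‖ ≤ 1) {M : ℝ} (hM : ∀ j, ‖S j‖ ≤ M) (j : ℕ) :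
    ‖alphaS π S F m T j‖ ≤ M := by
  by_cases hj : j < m
  · rw [alphaS_apply T hj]
    exact (norm_evalOn_le hT (gen_mem_wordSpan hj)).trans (hM j)
  · have : alphaS π S F m T j = 0 := dif_neg hj
    rw [this, norm_zero]
    exact (norm_nonneg _).trans (hM 0)

/-- The value at `x` of an almost equivariant map is determined, up to a small error, by its
values on the generating sequence. -/
theorem exists_linearMap_approx_evalOn (hp : p ≠ ∞) {π : UBRep R W} {S : ℕ → W}
    {Φ : Set (PMorph R)} {x : W} (hx : x ∈ wordSpanAll π S Φ) :
    ∃ (K : ℕ) (c : ℝ) (L : ∀ i, ellInfty (ellp p (Sig.d i)) →ₗ[ℂ] ellp p (Sig.d i)), 0 < c ∧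
      (∀ i (κ : ℝ) f, 0 < κ → (∀ k < K, CutSmall κ (f k)) → CutSmall (c * κ) (L i f)) ∧
      ∀ κ : ℝ, 0 < κ → ∀ᶠ t in paramFilter Φ, x ∈ wordSpan π S (paramSet t) t.2.1 ∧
        ∀ i, ∀ T ∈ almostHom p Sig π S (paramSet t) t.2.1 t.2.2 i,
          CutSmall κ (evalOn T x - L i (alphaS π S (paramSet t) t.2.1 T)) := by
  induction hx using Submodule.span_induction with
  | mem x hx =>
    obtain ⟨w, hw, j, rfl⟩ := hx
    -- Only the entry `j` is read, and a product of partial permutation matrices does not enlarge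
    -- errors.
    refine ⟨j + 1, 1, fun i =>
      { toFun := fun f => matApply p (w.map fun φ => Sig.σ i (vv φ)).prod (f j)
        map_add' := fun f g => matApply_add _ _ _
        map_smul' := fun c f => matApply_smul _ _ _ }, one_pos, ?_, ?_⟩
    · intro i κ f _ hf
      rw [one_mul]
      exact (hf j (Nat.lt_succ_self j)).word hp w
    · intro κ hκ
      filter_upwards [eventually_mem_words hw, eventually_lt_param j, eventually_param_lt hκ]
        with t h1 h2 h3
      refine ⟨act_mem_wordSpan h1 h2, fun i T hT => ?_⟩
      have := (cutSmall_of_mem_almostHom hT h1 h2).mono h3.le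
      rw [← alphaS_apply T h2] at this
      exact this
  | zero =>
    refine ⟨0, 1, fun i => 0, one_pos, fun i κ f hκ _ => ?_, fun κ hκ => ?_⟩
    · refine cutSmall_of_norm_lt ?_
      simpa using hκ
    · refine Eventually.of_forall fun t => ⟨Submodule.zero_mem _, fun i T _ => ?_⟩
      refine cutSmall_of_norm_lt ?_
      simpa [evalOn_zero] using hκ
  | add x y _ _ hx hy =>
    obtain ⟨K, c, L, hc, h1, h2⟩ := hx
    obtain ⟨K', c', L', hc', h1', h2'⟩ := hy
    refine ⟨max K K', c + c', fun i => L i + L' i, add_pos hc hc', fun i κ f hκ hf => ?_,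
      fun κ hκ => ?_⟩
    · rw [add_mul]
      exact (h1 i κ f hκ fun k hk => hf k (hk.trans_le (le_max_left _ _))).add hp
        (h1' i κ f hκ fun k hk => hf k (hk.trans_le (le_max_right _ _)))
    · filter_upwards [h2 _ (half_pos hκ), h2' _ (half_pos hκ)] with t e1 e2
      refine ⟨Submodule.add_mem _ e1.1 e2.1, fun i T hT => ?_⟩
      have := (e1.2 i T hT).add hp (e2.2 i T hT)
      rw [add_halves] at this
      convert this using 1
      rw [evalOn_add T e1.1 e2.1, LinearMap.add_apply]
      abel
  | smul b x _ hx =>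
    obtain ⟨K, c, L, hc, h1, h2⟩ := hx
    have hb : 0 < ‖b‖ + 1 := by positivity
    refine ⟨K, (‖b‖ + 1) * c, fun i => b • L i, mul_pos hb hc, fun i κ f hκ hf => ?_,
      fun κ hκ => ?_⟩
    · have hcκ : 0 < c * κ := mul_pos hc hκ
      refine (h1 i κ f hκ hf).smul b ?_ ?_
      · rw [mul_assoc]
        exact le_mul_of_one_le_left hcκ.le (by linarith [norm_nonneg b])
      · rw [mul_assoc, add_mul, one_mul]
        exact lt_add_of_pos_right _ hcκ
    · filter_upwards [h2 _ (div_pos hκ hb)] with t e1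
      refine ⟨Submodule.smul_mem _ b e1.1, fun i T hT => ?_⟩
      have k2 : κ / (‖b‖ + 1) ≤ κ := div_le_self hκ.le (by linarith [norm_nonneg b])
      have k3 : ‖b‖ * (κ / (‖b‖ + 1)) < κ := by
        rw [mul_div_assoc', div_lt_iff₀ hb]
        linarith
      convert (e1.2 i T hT).smul b k2 k3 using 1
      rw [evalOn_smul T b e1.1, LinearMap.smul_apply, smul_sub]

/-- Almost equivariance at a word of the composition of an almost equivariant map with a small
perturbation `θ` of an equivariant map. -/
theorem eventually_exists_norm_cut_lt [IsFiniteMeasure μ] (hp : p ≠ ∞) {π : UBRep R V} {S : ℕ → V}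
    {Φ : Set (PMorph R)} (hΦ : IsGenerating Φ) {w : List (PMorph R)} {q y : V}
    (hq : q ∈ wordSpanAll π S Φ) (hy : y ∈ wordSpanAll π S Φ) {β δ : ℝ} (hβ : 0 < β)
    (hqy : ‖q - π.act w.prod y‖ < δ) :
    ∀ᶠ t in paramFilter Φ, ∀ᶠ i in atTop,
      ∀ T ∈ almostHom p Sig π S (paramSet t) t.2.1 t.2.2 i,
        ∃ A : Finset (Fin (Sig.d i)), (Aᶜ.card : ℝ) ≤ β * Sig.d i ∧
          ‖cut A (evalOn T q -
            matApply p (w.map fun φ => Sig.σ i (vv φ)).prod (evalOn T y))‖ < δ := by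
  set γ : ℝ := δ - ‖q - π.act w.prod y‖ with hγ
  have hγ0 : 0 < γ := sub_pos.2 hqy
  -- Two exceptional sets have to fit into the fraction `β`, and three errors into the slack `γ`.
  set κ : ℝ := min (β / 2) (γ / 3) with hκ
  have hκ0 : 0 < κ := lt_min (by positivity) (by positivity)
  obtain ⟨z, hz, hn1, hn2⟩ := approximable_wordPair (Sig := Sig) (π := π) hΦ w {y}
    (Set.finite_singleton _) κ hκ0
  have hzy := hn1 y rfl
  rw [fst_wordPair] at hzy
  filter_upwards [intertwined hp hz hy κ hκ0, eventually_mem_wordSpan hq] with t h1 h2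
  filter_upwards [hn2] with i hi T hT
  rw [snd_wordPair] at hi
  have k1 := h1.2.2 i T hT
  have k2 : CutSmall κ (matApply p (-((w.map fun φ => Sig.σ i (vv φ)).prod - z.2 i))
      (evalOn T y)) :=
    cutSmall_matApply_of_rowSupp hκ0 (by rwa [rowSupp_neg]) _
  obtain ⟨A, hA, hcut⟩ := k1.add hp k2
  refine ⟨A, hA.trans ?_, ?_⟩
  · gcongr
    linarith [min_le_left (β / 2) (γ / 3)]
  · have hsplit : evalOn T q - matApply p (w.map fun φ => Sig.σ i (vv φ)).prod (evalOn T y) =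
        evalOn T (q - z.1 y) + ((evalOn T (z.1 y) - matApply p (z.2 i) (evalOn T y)) +
          matApply p (-((w.map fun φ => Sig.σ i (vv φ)).prod - z.2 i)) (evalOn T y)) := by
      rw [evalOn_sub T h2 h1.2.1, neg_matApply, sub_matApply]
      abel
    rw [hsplit, cut_add]
    have e1 : ‖cut A (evalOn T (q - z.1 y))‖ ≤ ‖q - π.act w.prod y‖ + κ := by
      refine (norm_cut_le _ _).trans ((norm_evalOn_le hT.1
        (Submodule.sub_mem _ h2 h1.2.1)).trans ?_)
      calc ‖q - z.1 y‖ = ‖(q - π.act w.prod y) + (π.act w.prod y - z.1 y)‖ := by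
            congr 1; abel
        _ ≤ ‖q - π.act w.prod y‖ + ‖π.act w.prod y - z.1 y‖ := norm_add_le _ _
        _ ≤ _ := by gcongr
    have e2 : κ ≤ γ / 3 := min_le_right _ _
    calc _ ≤ _ := norm_add_le _ _
      _ < (‖q - π.act w.prod y‖ + κ) + (κ + κ) := add_lt_add_of_le_of_lt e1 hcut
      _ ≤ δ := by linarith

/-- An almost equivariant map on `V`, composed with a small perturbation of an equivariant map
`W → V` and rescaled, is an almost equivariant map on `W`. -/
theorem eventually_comp_mem_almostHom [IsFiniteMeasure μ] (hp : p ≠ ∞) {πV : UBRep R V}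
    {πW : UBRep R W} {SV : ℕ → V} {SW : ℕ → W} {ΦV : Set (PMorph R)} (hΦV : IsGenerating ΦV)
    {F : Set (PMorph R)} (hF : F.Finite) {m : ℕ} {δ : ℝ} (hδ : 0 < δ)
    (θ : wordSpan πW SW F m →L[ℂ] V) (hθ : ∀ x, θ x ∈ wordSpanAll πV SV ΦV)
    {c : ℂ} (hc : ‖c‖ * ‖θ‖ ≤ 1)
    (happ : ∀ (w : List (PMorph R)) (hw : w ∈ words F m) (j : ℕ) (hj : j < m),
      ‖c‖ * ‖θ (wordVec πW SW F m w hw j hj) - πV.act w.prod (θ (genVec πW SW F m j hj))‖ < δ) :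
    ∀ᶠ t in paramFilter ΦV, ∃ hmem : ∀ x, θ x ∈ wordSpan πV SV (paramSet t) t.2.1,
      ∀ᶠ i in atTop, ∀ T ∈ almostHom p Sig πV SV (paramSet t) t.2.1 t.2.2 i,
        c • T.comp (θ.codRestrict _ hmem) ∈ almostHom p Sig πW SW F m δ i := by
  classical
  have hfd : FiniteDimensional ℂ (wordSpan πW SW F m) := finiteDimensional_wordSpan πW SW hF m
  have hmem : ∀ᶠ t in paramFilter ΦV, ∀ x, θ x ∈ wordSpan πV SV (paramSet t) t.2.1 := by
    obtain ⟨s, hs⟩ := (Module.Finite.fg_top : (⊤ : Submodule ℂ (wordSpan πW SW F m)).FG)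
    filter_upwards [(Finset.eventually_all s).2 fun x _ => eventually_mem_wordSpan (hθ x)]
      with t ht x
    have hle : (⊤ : Submodule ℂ (wordSpan πW SW F m)) ≤
        (wordSpan πV SV (paramSet t) t.2.1).comap (θ : wordSpan πW SW F m →ₗ[ℂ] V) := by
      rw [← hs, Submodule.span_le]
      exact ht
    exact hle (Submodule.mem_top (x := x))
  -- Almost equivariance on `W` asks for one exceptional set serving all words and indices. There
  -- are finitely many of these, so each is granted a fraction `δ / (|I| + 1)`.
  set I : Finset {a : List (PMorph R) × ℕ // a.1 ∈ words F m ∧ a.2 < m} :=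
    @Finset.univ _ (@Fintype.ofFinite _
      ((((finite_words hF m).prod (Set.finite_lt_nat m)).subset (by
        rintro a ⟨h1, h2⟩
        exact ⟨h1, h2⟩ : {a : List (PMorph R) × ℕ | a.1 ∈ words F m ∧ a.2 < m} ⊆ _)).to_subtype))
    with hI
  have hImem : ∀ a, a ∈ I := fun a => by simp [hI]
  have hIc : (0 : ℝ) < I.card + 1 := by positivity
  set β : ℝ := δ / (I.card + 1) with hβ
  have hβ0 : 0 < β := by positivity
  have hev : ∀ᶠ t in paramFilter ΦV, ∀ a ∈ I, ∀ᶠ i in atTop,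
      ∀ T ∈ almostHom p Sig πV SV (paramSet t) t.2.1 t.2.2 i,
        ∃ A : Finset (Fin (Sig.d i)), (Aᶜ.card : ℝ) ≤ β * Sig.d i ∧
          ‖cut A (evalOn T (c • θ (wordVec πW SW F m a.1.1 a.2.1 a.1.2 a.2.2)) -
            matApply p (a.1.1.map fun φ => Sig.σ i (vv φ)).prod
              (evalOn T (c • θ (genVec πW SW F m a.1.2 a.2.2))))‖ < δ := by
    refine (Finset.eventually_all I).2 fun a _ => ?_
    refine eventually_exists_norm_cut_lt hp hΦV (Submodule.smul_mem _ c (hθ _))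
      (Submodule.smul_mem _ c (hθ _)) hβ0 ?_
    rw [map_smul, ← smul_sub, norm_smul]
    exact happ _ _ _ _
  filter_upwards [hmem, hev] with t ht hevt
  refine ⟨ht, ?_⟩
  filter_upwards [(Finset.eventually_all I).2 hevt] with i hi T hT
  choose! A hA hcut using fun a ha => hi a ha T hT
  have happly : ∀ x, (c • T.comp (θ.codRestrict _ ht)) x = evalOn T (c • θ x) := by
    intro x
    rw [evalOn_smul T c (ht x), evalOn_of_mem T (ht x)]
    rfl
  refine ⟨?_, (I.biUnion fun a => (A a)ᶜ)ᶜ, ?_, ?_⟩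
  · refine ContinuousLinearMap.opNorm_le_bound _ zero_le_one fun x => ?_
    rw [happly]
    refine (norm_evalOn_le hT.1 (Submodule.smul_mem _ c (ht x))).trans ?_
    rw [norm_smul]
    calc ‖c‖ * ‖θ x‖ ≤ ‖c‖ * (‖θ‖ * ‖x‖) := by
          gcongr
          exact θ.le_opNorm x
      _ = (‖c‖ * ‖θ‖) * ‖x‖ := by ring
      _ ≤ 1 * ‖x‖ := by gcongr
  · rw [card_le_iff_compl, compl_compl]
    refine (card_compl_biUnion_le I A fun a ha => hA a ha).trans ?_
    gcongr
    rw [hβ, mul_div_assoc', div_le_iff₀ hIc]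
    nlinarith
  · intro w hw j hj
    rw [happly, happly]
    exact (norm_cut_mono hp (compl_biUnion_compl_subset (hImem ⟨(w, j), hw, hj⟩)) _).trans_lt
      (hcut ⟨(w, j), hw, hj⟩ (hImem _))

end Comparison

/-! ### Comparison of the dimensions -/

section Main

variable {X : Type*} [MeasurableSpace X] {μ : Measure X} [StandardBorelSpace X] {R : MPRel X μ}
  {V : Type*} [NormedAddCommGroup V] [NormedSpace ℂ V]
  {W : Type*} [NormedAddCommGroup W] [NormedSpace ℂ W]
  {Sig : SoficApprox R} {p : ℝ≥0∞} [Fact (1 ≤ p)]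

theorem norm_cutNormSeq_apply {n : ℕ} (C : Finset (Fin n)) (f : ellInfty (ellp p n)) (j : ℕ) :
    ‖cutNormSeq C f j‖ = ‖cut C (f j)‖ := by
  change ‖((‖cut C (f j)‖ : ℝ) : ℂ)‖ = _
  rw [Complex.norm_real, norm_norm]

/-- As `T` is equivariant, the equivariance defect of `θ` is that of `θ - T`. -/
theorem norm_sub_act_le {πV : UBRep R V} {πW : UBRep R W} {T : W →L[ℂ] V}
    (hT : ∀ (φ : PMorph R) (w : W), T (πW.act φ w) = πV.act φ (T w)) {U : Submodule ℂ W}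
    (θ : U →L[ℂ] V) {η : ℝ} (hη : 0 ≤ η) (hθ : ∀ x, ‖θ x - T x‖ ≤ η * ‖x‖) {CV CW : ℝ}
    (hCV : ∀ φ, ‖πV.act φ‖ ≤ CV) (hCW : ∀ φ, ‖πW.act φ‖ ≤ CW) (φ : PMorph R)
    {x y : U} (hxy : (x : W) = πW.act φ y) :
    ‖θ x - πV.act φ (θ y)‖ ≤ η * ((CW + CV) * ‖y‖) := by
  have hx : ‖x‖ ≤ CW * ‖y‖ := by
    change ‖(x : W)‖ ≤ CW * ‖(y : W)‖
    rw [hxy]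
    exact (πW.act φ).le_of_opNorm_le (hCW φ) _
  calc ‖θ x - πV.act φ (θ y)‖ = ‖(θ x - T x) - πV.act φ (θ y - T y)‖ := by
        rw [map_sub, hxy, hT]; congr 1; abel
    _ ≤ ‖θ x - T x‖ + ‖πV.act φ (θ y - T y)‖ := norm_sub_le _ _
    _ ≤ η * (CW * ‖y‖) + CV * (η * ‖y‖) := by
        have hCV0 : 0 ≤ CV := (norm_nonneg _).trans (hCV φ)
        refine add_le_add ((hθ x).trans (by gcongr)) ?_
        refine ((πV.act φ).le_of_opNorm_le (hCV φ) _).trans ?_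
        gcongr
        exact hθ y
    _ = _ := by ring

/-- The order of choices is essential: the vectors `x j`, the linear maps `L j` and `ε'` depend on
`ε` only; the perturbation `θ` depends on the parameters `t'` of `W`; the parameters `t` of `V` come
last. -/
theorem exists_eventually_fdimLocal_le [IsFiniteMeasure μ] (hp : p ≠ ∞) {πV : UBRep R V}
    {πW : UBRep R W} {T : W →L[ℂ] V}
    (hT : ∀ (φ : PMorph R) (w : W), T (πW.act φ w) = πV.act φ (T w)) (hdense : DenseRange T)
    {SV : ℕ → V} (hSV : DynGenerating πV SV) {SW : ℕ → W} (hSW : DynGenerating πW SW)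
    {ΦV ΦW : Set (PMorph R)} (hΦV : IsGenerating ΦV) (hΦW : IsGenerating ΦW)
    (ρV ρW : ProductNorm) {ε : ℝ} (hε : 0 < ε) :
    ∃ ε' : ℝ, 0 < ε' ∧ ∀ᶠ t' in paramFilter ΦW, ∀ᶠ t in paramFilter ΦV,
      fdimLocal p Sig πV SV ρV (paramSet t) t.2.1 t.2.2 ε ≤
        fdimLocal p Sig πW SW ρW (paramSet t') t'.2.1 t'.2.2 ε' := by
  obtain ⟨MV, hMV⟩ := hSV.1
  obtain ⟨MW, hMW⟩ := hSW.1
  obtain ⟨CV, hCV⟩ := πV.bounded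
  obtain ⟨CW, hCW⟩ := πW.bounded
  have hMV0 : 0 ≤ MV := (norm_nonneg _).trans (hMV 0)
  have hMW0 : 0 ≤ MW := (norm_nonneg _).trans (hMW 0)
  have hCV0 : 0 ≤ CV := (norm_nonneg _).trans (hCV 1)
  have hCW0 : 0 ≤ CW := (norm_nonneg _).trans (hCW 1)
  obtain ⟨J, κ, hκ, hρV⟩ := ρV.exists_apply_lt_of_le hMV0 hε
  -- The bound `κ` is for the norms; the second bound lets `J` exceptional sets fit into the
  -- fraction `ε`.
  set κ' : ℝ := min κ (ε / (J + 1)) with hκ'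
  have hκ'0 : 0 < κ' := lt_min hκ (by positivity)
  have hx : ∀ j, ∃ x ∈ wordSpanAll πW SW ΦW, ‖SV j - T x‖ < κ' / 4 := fun j => by
    obtain ⟨_, ⟨x, hx, rfl⟩, hd⟩ := Metric.mem_closure_iff.1
      ((hdense.dense_image T.continuous (dense_wordSpanAll Sig hΦW hSW)) (SV j)) (κ' / 4)
      (by positivity)
    exact ⟨x, hx, by rwa [dist_eq_norm] at hd⟩
  choose x hxmem hxT using hx
  choose K c L hc hL1 hL2 using fun j =>
    exists_linearMap_approx_evalOn (Sig := Sig) hp (hxmem j)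
  set b : ℝ := ‖T‖ + 1 with hb
  have hb1 : 1 ≤ b := by linarith [norm_nonneg T]
  have hb0 : 0 < b := by linarith
  set cs : ℝ := ∑ j ∈ Finset.range J, c j + 1 with hcs
  have hcs0 : 0 < cs := add_pos_of_nonneg_of_pos (Finset.sum_nonneg fun j _ => (hc j).le) one_pos
  have hccs : ∀ j < J, c j ≤ cs := fun j hj => by
    have := Finset.single_le_sum (f := c) (fun j _ => (hc j).le) (Finset.mem_range.2 hj)
    linarith
  have hKK : ∀ j < J, K j ≤ ∑ j ∈ Finset.range J, K j := fun j hj =>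
    Finset.single_le_sum (f := K) (fun j _ => Nat.zero_le _) (Finset.mem_range.2 hj)
  -- Accuracy `κ₁` on the entries of `g` becomes at most `κ₂` after `L j`. Together with the error
  -- `κ₂` of recovering `T₂ (x j)` and after rescaling by `b`, this costs `κ' / 4`.
  set κ₁ : ℝ := κ' / (8 * b) / cs with hκ₁
  set κ₂ : ℝ := κ' / (8 * b) with hκ₂
  have hκ₂0 : 0 < κ₂ := by positivity
  have hκ₁0 : 0 < κ₁ := by positivity
  obtain ⟨ε₁, hε₁, hρW⟩ := ρW.exists_lt_of_apply_lt (∑ j ∈ Finset.range J, K j) hκ₁0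
  refine ⟨min ε₁ κ₁, lt_min hε₁ hκ₁0, ?_⟩
  filter_upwards [(Finset.eventually_all (Finset.range J)).2 fun j _ => hL2 j κ₂ hκ₂0,
    eventually_param_pos] with t' ht' hδ
  have hfin : (paramSet t').Finite := t'.1.finite_toSet.image _
  have hfd := finiteDimensional_wordSpan πW SW hfin t'.2.1
  set B : ℝ := (CW + CV) * MW with hB
  have hB0 : 0 ≤ B := by positivity
  set xs : ℝ := ∑ j ∈ Finset.range J, ‖x j‖ with hxs
  have hxs0 : 0 ≤ xs := Finset.sum_nonneg fun j _ => norm_nonneg _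
  have hxle : ∀ j < J, ‖x j‖ ≤ xs := fun j hj =>
    Finset.single_le_sum (f := fun j => ‖x j‖) (fun j _ => norm_nonneg _) (Finset.mem_range.2 hj)
  -- The three bounds ensure `‖θ‖ ≤ ‖T‖ + 1`, an equivariance defect below the tolerance of `t'`,
  -- and `‖θ (x j) - T (x j)‖ ≤ κ' / 4`.
  set η : ℝ := min 1 (min (t'.2.2 / (B + 1)) (κ' / 4 / (xs + 1))) with hη
  have hη0 : 0 < η := lt_min one_pos (lt_min (by positivity) (by positivity))
  have hη1 : η ≤ 1 := min_le_left _ _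
  have hηB : η * B < t'.2.2 := by
    have : η * (B + 1) ≤ t'.2.2 :=
      (le_div_iff₀ (by positivity)).1 ((min_le_right _ _).trans (min_le_left _ _))
    linarith
  have hηx : η * xs ≤ κ' / 4 := by
    have : η * (xs + 1) ≤ κ' / 4 :=
      (le_div_iff₀ (by positivity)).1 ((min_le_right _ _).trans (min_le_right _ _))
    linarith
  obtain ⟨θ, hθmem, hθ⟩ := exists_continuousLinearMap_near
    (T.comp (wordSpan πW SW (paramSet t') t'.2.1).subtypeL)
    (dense_wordSpanAll Sig hΦV hSV) hη0
  replace hθ : ∀ y, ‖θ y - T y‖ ≤ η * ‖y‖ := hθ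
  have hcn : ‖((b⁻¹ : ℝ) : ℂ)‖ = b⁻¹ := by
    rw [Complex.norm_real, Real.norm_of_nonneg (by positivity)]
  have hθn : ‖θ‖ ≤ b := by
    refine θ.opNorm_le_bound hb0.le fun y => ?_
    calc ‖θ y‖ = ‖T y + (θ y - T y)‖ := by congr 1; abel
      _ ≤ ‖T y‖ + ‖θ y - T y‖ := norm_add_le _ _
      _ ≤ ‖T‖ * ‖y‖ + 1 * ‖y‖ := by
        refine add_le_add (T.le_opNorm _) ((hθ y).trans ?_)
        gcongr
      _ = b * ‖y‖ := by rw [hb, add_mul]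
  have hcθ : ‖((b⁻¹ : ℝ) : ℂ)‖ * ‖θ‖ ≤ 1 := by
    rw [hcn, inv_mul_le_iff₀ hb0, mul_one]
    exact hθn
  have happ : ∀ (w : List (PMorph R)) (hw : w ∈ words (paramSet t') t'.2.1) (j : ℕ)
      (hj : j < t'.2.1), ‖((b⁻¹ : ℝ) : ℂ)‖ *
        ‖θ (wordVec πW SW (paramSet t') t'.2.1 w hw j hj) -
          πV.act w.prod (θ (genVec πW SW (paramSet t') t'.2.1 j hj))‖ < t'.2.2 := by
    intro w hw j hj
    have h1 := norm_sub_act_le hT θ hη0.le hθ hCV hCW w.prod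
      (x := wordVec πW SW (paramSet t') t'.2.1 w hw j hj)
      (y := genVec πW SW (paramSet t') t'.2.1 j hj) rfl
    have h2 : ‖genVec πW SW (paramSet t') t'.2.1 j hj‖ ≤ MW := hMW j
    have h3 : η * ((CW + CV) * ‖genVec πW SW (paramSet t') t'.2.1 j hj‖) ≤ η * B := by
      rw [hB]
      gcongr
    rw [hcn]
    refine lt_of_le_of_lt (mul_le_of_le_one_left (norm_nonneg _) (inv_le_one_of_one_le₀ hb1)) ?_
    linarith
  filter_upwards [eventually_comp_mem_almostHom (Sig := Sig) hp hΦV hfin hδ θ hθmem hcθ happ,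
    eventually_lt_param J] with t ht hJt
  obtain ⟨hmem, hev⟩ := ht
  refine limsup_le_limsup ?_
  filter_upwards [hev] with i hi
  refine ENNReal.div_le_div_right (epsDim_le_epsDim (seqMap J fun j => (b : ℂ) • L j i) ?_) _
  rintro _ ⟨T₁, hT₁, rfl⟩
  refine ⟨_, ⟨_, hi T₁ hT₁, rfl⟩, fun g C hC hlt => ?_⟩
  set T₂ := ((b⁻¹ : ℝ) : ℂ) • T₁.comp (θ.codRestrict _ hmem) with hT₂
  set f' := alphaS πW SW (paramSet t') t'.2.1 T₂ with hf'
  set f := alphaS πV SV (paramSet t) t.2.1 T₁ with hf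
  have hsmall : ∀ k < ∑ j ∈ Finset.range J, K j, CutSmall κ₁ ((f' - g) k) := by
    intro k hk
    refine ⟨C, ((card_le_iff_compl _ _).1 hC).trans ?_, ?_⟩
    · gcongr
      exact min_le_right _ _
    · have := hρW _ (hlt.trans_le (min_le_left _ _)) k hk
      rwa [norm_cutNormSeq_apply] at this
  have hj : ∀ j ∈ Finset.range J, CutSmall κ' (f j - (b : ℂ) • L j i g) := by
    intro j hj
    have hjJ := Finset.mem_range.1 hj
    obtain ⟨hxj, hxL⟩ := ht' j hj
    have e1 := hxL i T₂ (hi T₁ hT₁)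
    have e2 := (hL1 j i κ₁ _ hκ₁0 fun k hk => hsmall k (hk.trans_le (hKK j hjJ))).mono
      (show c j * κ₁ ≤ κ₂ by
        rw [hκ₁, mul_div_assoc', div_le_iff₀ hcs0, mul_comm]
        gcongr
        exact hccs j hjJ)
    -- The error splits as `T₁ (SV j) - b L_j g = T₁ (SV j - θ (x j)) + b (T₂ (x j) - L_j g)`,
    -- because `b T₂ = T₁ ∘ θ`; each summand gets `κ' / 2`.
    have e3 : CutSmall (κ' / 2) ((b : ℂ) • (evalOn T₂ (x j) - L j i g)) := by
      have e4 := e1.add hp e2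
      rw [map_sub, sub_add_sub_cancel] at e4
      have e5 : κ₂ + κ₂ = κ' / 4 / b := by
        rw [hκ₂]
        field_simp
        norm_num
      rw [e5] at e4
      refine e4.smul (b : ℂ) ?_ ?_
      · exact (div_le_self (by positivity) hb1).trans (by linarith)
      · rw [Complex.norm_real, Real.norm_of_nonneg hb0.le, mul_div_cancel₀ _ hb0.ne']
        linarith
    have e6 : (b : ℂ) • evalOn T₂ (x j) = evalOn T₁ (θ ⟨x j, hxj⟩) := by
      rw [evalOn_of_mem T₂ hxj, evalOn_of_mem T₁ (hmem ⟨x j, hxj⟩), hT₂]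
      change (b : ℂ) • ((b⁻¹ : ℝ) : ℂ) • T₁ _ = _
      rw [smul_smul, ← Complex.ofReal_mul, mul_inv_cancel₀ hb0.ne', Complex.ofReal_one, one_smul]
      rfl
    have hSmem : SV j ∈ wordSpan πV SV (paramSet t) t.2.1 := gen_mem_wordSpan (hjJ.trans hJt)
    have e7 : CutSmall (κ' / 2) (evalOn T₁ (SV j - θ ⟨x j, hxj⟩)) := by
      refine cutSmall_of_norm_lt
        ((norm_evalOn_le hT₁.1 (Submodule.sub_mem _ hSmem (hmem _))).trans_lt ?_)
      have h1 : ‖θ ⟨x j, hxj⟩ - T (x j)‖ ≤ η * ‖x j‖ := hθ ⟨x j, hxj⟩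
      have h2 : η * ‖x j‖ ≤ η * xs := by
        gcongr
        exact hxle j hjJ
      calc ‖SV j - θ ⟨x j, hxj⟩‖ = ‖(SV j - T (x j)) - (θ ⟨x j, hxj⟩ - T (x j))‖ := by
            congr 1; abel
        _ ≤ ‖SV j - T (x j)‖ + ‖θ ⟨x j, hxj⟩ - T (x j)‖ := norm_sub_le _ _
        _ < κ' / 2 := by linarith [hxT j]
    have e8 := e7.add hp e3
    rw [add_halves, evalOn_sub T₁ hSmem (hmem _), smul_sub, e6, sub_add_sub_cancel,
      ← alphaS_apply T₁ (hjJ.trans hJt)] at e8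
    exact e8
  choose! A hA hcut using hj
  refine ⟨((Finset.range J).biUnion fun j => (A j)ᶜ)ᶜ, ?_, hρV _ ?_ ?_⟩
  · rw [card_le_iff_compl, compl_compl]
    refine (card_compl_biUnion_le _ A hA).trans ?_
    gcongr
    rw [Finset.card_range]
    have h1 : κ' * (J + 1) ≤ ε := (le_div_iff₀ (by positivity)).1 (min_le_right _ _)
    nlinarith
  · intro j hj
    rw [norm_cutNormSeq_apply, lp.coeFn_sub, Pi.sub_apply, seqMap_apply, if_pos hj]
    refine (norm_cut_mono hp (compl_biUnion_compl_subset (Finset.mem_range.2 hj)) _).trans ?_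
    exact (hcut j (Finset.mem_range.2 hj)).le.trans (min_le_left _ _)
  -- From `J` on the approximant is `0`, and the bound on the generators suffices.
  · intro j hj
    rw [norm_cutNormSeq_apply, lp.coeFn_sub, Pi.sub_apply, seqMap_apply, if_neg (not_lt.2 hj),
      sub_zero]
    exact (norm_cut_le _ _).trans (norm_alphaS_apply_le hT₁.1 hMV j)

/-- For each late `t'` the comparison holds along all late `t`, so the whole lower limit over `t`
lies below the value at `t'`, hence below the lower limit over `t'`. -/
theorem fdim_le_of_denseRange [IsFiniteMeasure μ] (hp : p ≠ ∞) {πV : UBRep R V}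
    {πW : UBRep R W} {T : W →L[ℂ] V}
    (hT : ∀ (φ : PMorph R) (w : W), T (πW.act φ w) = πV.act φ (T w)) (hdense : DenseRange T)
    {SV : ℕ → V} (hSV : DynGenerating πV SV) {SW : ℕ → W} (hSW : DynGenerating πW SW)
    {ΦV ΦW : Set (PMorph R)} (hΦV : IsGenerating ΦV) (hΦW : IsGenerating ΦW)
    (ρV ρW : ProductNorm) : fdim p Sig πV SV ΦV ρV ≤ fdim p Sig πW SW ΦW ρW := by
  refine iSup₂_le fun ε hε => ?_
  obtain ⟨ε', hε', h⟩ := exists_eventually_fdimLocal_le (Sig := Sig) hp hT hdense hSV hSW hΦV hΦW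
    ρV ρW hε
  refine le_trans ?_ (le_iSup₂ (f := fun (ε : ℝ) (_ : 0 < ε) =>
    liminf (fun t : Finset ΦW × ℕ × ℝ =>
      fdimLocal p Sig πW SW ρW (Subtype.val '' (t.1 : Set ΦW)) t.2.1 t.2.2 ε)
      (atTop ×ˢ (atTop ×ˢ 𝓝[>] (0 : ℝ)))) ε' hε')
  refine le_liminf_of_le (by isBoundedDefault) ?_
  filter_upwards [h] with t' ht'
  refine (liminf_le_liminf ht').trans ?_
  rw [liminf_const]

end Main

end LpDim

theorem mainTheorem4 {X : Type*} [MeasurableSpace X] [StandardBorelSpace X]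
    (μ : MeasureTheory.Measure X) [MeasureTheory.IsProbabilityMeasure μ]
    (R : LpDim.MPRel X μ) (Sig : LpDim.SoficApprox R)
    (p : ENNReal) [Fact (1 ≤ p)] (hp : p ≠ ⊤)
    {V : Type*} [NormedAddCommGroup V] [NormedSpace ℂ V] [CompleteSpace V]
    {W : Type*} [NormedAddCommGroup W] [NormedSpace ℂ W] [CompleteSpace W]
    (πV : LpDim.UBRep R V) (πW : LpDim.UBRep R W)
    (T : W →L[ℂ] V) (hT : ∀ (φ : LpDim.PMorph R) (w : W), T (πW.act φ w) = πV.act φ (T w))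
    (SV : ℕ → V) (hSV : LpDim.DynGenerating πV SV)
    (SW : ℕ → W) (hSW : LpDim.DynGenerating πW SW)
    (ΦV ΦW : Set (LpDim.PMorph R))
    (hΦV : LpDim.IsGenerating ΦV) (hΦW : LpDim.IsGenerating ΦW)
    (ρV ρW : LpDim.ProductNorm) :
    (DenseRange T →
      LpDim.fdim p Sig πV SV ΦV ρV ≤ LpDim.fdim p Sig πW SW ΦW ρW) ∧
    (Function.Bijective T →
      LpDim.fdim p Sig πV SV ΦV ρV = LpDim.fdim p Sig πW SW ΦW ρW) := by
  refine ⟨fun h => LpDim.fdim_le_of_denseRange hp hT h hSV hSW hΦV hΦW ρV ρW, fun h => ?_⟩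
  refine le_antisymm
    (LpDim.fdim_le_of_denseRange hp hT h.2.denseRange hSV hSW hΦV hΦW ρV ρW) ?_
  -- Completeness of both spaces enters here: by the open mapping theorem the inverse is bounded. It
  -- is equivariant too, so the inequality applies in the other direction.
  set e : W ≃L[ℂ] V := ContinuousLinearEquiv.ofBijective T
    (LinearMap.ker_eq_bot.2 h.1) (LinearMap.range_eq_top.2 h.2) with he
  have heT : ∀ w, e w = T w := fun w => rfl
  refine LpDim.fdim_le_of_denseRange (T := (e.symm : V →L[ℂ] W)) hp (fun φ v => ?_)
    e.symm.surjective.denseRange hSW hSV hΦW hΦV ρW ρV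
  apply e.injective
  change e (e.symm _) = e (πW.act φ (e.symm v))
  rw [e.apply_symm_apply, heT, hT, ← heT, e.apply_symm_apply]
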